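/- **Policies.** Fix a set of locks and a set of actors. A *clause* $\Sigma\Rightarrow a$ is a lock set $\Sigma$ with an actor $a$; a *policy* is a set of clauses. $p\sqsubseteq q$ means: for every $(\Sigma\Rightarrow a)\in q$ there is $(\Sigma'\Rightarrow a)\in p$ with $\Sigma'\subseteq\Sigma$. Put $\bot=\{\emptyset\Rightarrow a\mid a \text{ an actor}\}$, $\top=\emptyset$, $p\sqcup q=\{\Sigma_1\cup\Sigma_2\Rightarrow a\mid (\Sigma_1\Rightarrow a)\in p,(\Sigma_2\Rightarrow a)\in q\}$, $p(\Sigma)=\{\Sigma_1\setminus\Sigma\Rightarrow a\mid(\Sigma_1\Rightarrow a)\in p\}$. Every lock $\sigma$ has a policy $\mathrm{LP}(\sigma)$. An *attacker* $\mathcal A$ is an actor $a$ with a lock set $\Sigma_{\mathcal A}$; $p\sqsubseteq\mathcal A$ ("visible") means $p\sqsubseteq\{\Sigma_{\mathcal A}\Rightarrow a\}$, and for a lock set $\Sigma\sqsubseteq\mathcal A$ means $\Sigma\subseteq\Sigma_{\mathcal A}$. $\Sigma\approx_{\mathcal A}\Sigma'$ means that $\Sigma$ and $\Sigma'$ contain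 the same locks of visible policy. **Language.** Types $A::=\mathsf{unit}\mid\mathbb N\mid\tau+\tau\mid\tau\times\tau\mid\mathsf{ref}\,\tau\mid\tau\xrightarrow{\Sigma,pc}\tau$; annotated types $\tau::=A^p$; an annotated type is compared with policies, and with $\mathcal A$, through its outermost policy; $A^p(\Sigma)=A^{p(\Sigma)}$. Expressions (up to renaming of bound variables): $x$, $()$, $n$, $\lambda x.e$, $(e,e')$, $\mathsf{fst}$, $\mathsf{snd}$, $\mathsf{inl}$, $\mathsf{inr}$, $\mathsf{case}$, application, $\mathsf{new}(e,\tau)$, $!e$, $e:=e'$, $\mathsf{open}\,\sigma\,e$, $\mathsf{opened}\,\sigma\,e$, $\mathsf{close}\,\sigma\,e$, $\mathsf{closed}\,\sigma\,e$, $\mathsf{when}\,\sigma\,e\,e'$, locations $l\in\mathbb N$. Values: $\lambda x.e$, pairs and injections of values, $()$, $n$, $l$. A *state* $S$ maps finitely many locations to a value and a type; $\theta_S$ is its map from locations to types. A *state environment* $\theta$ is a partial map from locations to types; $\theta^L$ extends $\theta$ by $\theta_L$ outside $\mathrm{dom}\,\theta$. Reduction $e,\Sigma,S\to e',S',\omega,\Sigma'$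 ($\Sigma$ open locks, $\omega$ observation, $\Sigma'$ active lock set, i.e. the lock set at the redex) is left-to-right call-by-value, with congruence rules for all evaluation positions; $\mathsf{opened}\,\sigma$ and $\mathsf{closed}\,\sigma$ reduce their body with open locks $\Sigma\cup\{\sigma\}$ and $\Sigma\setminus\{\sigma\}$; $\mathsf{when}\,\sigma\,e\,e'$ reduces $e$ in place if $\sigma\in\Sigma$, else $e'$ in place, and returns the value of that branch. $\mathsf{new}(v,\tau)$ allocates any $l\notin\mathrm{dom}\,S$ and emits the write $l_\tau(v)$; $l:=v$ with $\theta_S(l)=\tau$ keeps the type $\tau$ at $l$ and emits $l_\tau(v)$; $\mathsf{open}\,\sigma\,e\to\mathsf{opened}\,\sigma\,e$ emits $\mathrm{open}(\sigma)$, $\mathsf{opened}\,\sigma\,v\to v$ emits $\mathrm{unopen}(\sigma)$, and likewise for $\mathsf{close}$; all other redexes emit the empty observation $\epsilon$. The policy of $l_{A^p}(v)$ is $p$, that of a lock observation is $\mathrm{LP}(\sigma)$; $\epsilon$ has none and is not visible. **Type system** $\Gamma;\Sigma;\theta\vdash_{pc}e:\tau$. Subtyping: $A^p<:B^{q}$ if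 $p\sqsubseteq q$ and $A<:B$; $\mathsf{unit}$, $\mathbb N$, $\mathsf{ref}\,\tau$ are subtypes only of themselves; sums and products are covariant; $\tau_1\xrightarrow{\Sigma,p}\tau_2<:\tau_0\xrightarrow{\Sigma',p'}\tau_3$ if $\tau_0<:\tau_1$, $\tau_2<:\tau_3$, $p'\sqsubseteq p$, $\Sigma\subseteq\Sigma'$. Typing is standard for variables, constants, $\lambda$ (whose body is typed under the latent $\Sigma',pc'$ of the arrow), pairs, injections, and locations $l:(\mathsf{ref}\,\theta(l))^\bot$ (introduction forms get policy $\bot$). Eliminating ($\mathsf{fst},\mathsf{snd},\mathsf{case}$, application, $!$) something of policy $p$ requires $p\sqsubseteq$ the result type; $\mathsf{case}$ branches are typed at $pc\sqcup p$; application of $\tau_1\xrightarrow{\Sigma',pc'}\tau_2$ requires $pc\sqcup p\sqsubseteq pc'$, $\Sigma'\subseteq\Sigma$ and an argument of a subtype of $\tau_1$; $!e$ may raise $\tau$ to a supertype; $\mathsf{new}(e,\tau):(\mathsf{ref}\,\tau)^\bot$ for $e:\tau'$ with $pc\sqsubseteq\tau$, $\tau'(\Sigma)<:\tau$; $e:=e'$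 for $e:(\mathsf{ref}\,\tau')^p$, $e':\tau$ with $\tau(\Sigma)<:\tau'$, $pc\sqcup p\sqsubseteq\tau'$; the bodies of $\mathsf{open},\mathsf{opened}$ (resp. $\mathsf{close},\mathsf{closed}$) are typed under $\Sigma\cup\{\sigma\}$ (resp. $\Sigma\setminus\{\sigma\}$) and $pc\sqsubseteq\mathrm{LP}(\sigma)$; the branches of $\mathsf{when}\,\sigma$ under $\Sigma\cup\{\sigma\}$ and $\Sigma$, at $pc\sqcup\mathrm{LP}(\sigma)$, with $\mathrm{LP}(\sigma)\sqsubseteq\tau$. If $e:\tau'$ at $pc'$, $pc\sqsubseteq pc'$ and $\tau'<:\tau$, then $e:\tau$ at $pc$. Write $S\vdash\theta$ if every $l\in\mathrm{dom}\,\theta$ lies in $\mathrm{dom}\,S$, $\theta_S(l)=\theta(l)$ and $\cdot;\emptyset;\theta\vdash_\top S(l):\theta(l)$. **Unary relation.** $(v,\theta,m)\in\lfloor A^p\rfloor$ iff $(v,\theta,m)\in\lfloor A\rfloor$; it is structural on $\mathsf{unit},\mathbb N,+,\times$; $(l,\theta,m)\in\lfloor\mathsf{ref}\,\tau\rfloor$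 iff $\theta(l)=\tau$; $(\lambda x.e,\theta,m)\in\lfloor\tau_1\xrightarrow{\Sigma,pc}\tau_2\rfloor$ iff for all $\theta'\supseteq\theta$, $m'<m$, $(v,\theta',m')\in\lfloor\tau_1\rfloor$: $([v/x]e,\theta',m')\in E[\tau_2]_{pc}$. $(e,\theta,m)\in E[\tau]_{pc}$ iff $(e,\theta,m)\in\lfloor\tau\rfloor$, or $e$ is not a value and for all $\theta'\supseteq\theta$, $m'<m$, $(S,m')\triangleright\theta'$ and every step $e,\Sigma,S\to e',S',\omega,\Sigma'$: $\omega=\epsilon$ or $pc\sqsubseteq$ the policy of $\omega$, and there is $\theta''\supseteq\theta'$ with $(S',m')\triangleright\theta''$ and $(e',\theta'',m')\in E[\tau]_{pc}$. Here $(S,m)\triangleright\theta$ means $\theta\subseteq\theta_S$ and $(S(l),\theta,m)\in\lfloor\theta(l)\rfloor$ for $l\in\mathrm{dom}\,\theta$. **Binary relation.** A *world* $W=(\theta_1,\theta_2,\beta)$ consists of two state environments and a partial bijection $\beta$ of locations; $W\sqsubseteq W'$ is componentwise inclusion. $(v,v',W,m)\in V[A^p]$ iff either $p\sqsubseteq\mathcal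 A$ and $(v,v',W,m)\in V[A]$, or $p\not\sqsubseteq\mathcal A$, $(v,\theta_1,m)\in\lfloor A\rfloor$ and $(v',\theta_2,m)\in\lfloor A\rfloor$. $V[A]$ is equality on $\mathsf{unit}$ and $\mathbb N$ and structural on $+,\times$; $(l,l')\in V[\mathsf{ref}\,\tau]$ iff $\theta_1(l)=\tau=\theta_2(l')$ and $(l,l')\in\beta$; $(\lambda x.e_1,\lambda x.e_2,W,m)\in V[\tau_1\xrightarrow{\Sigma,pc}\tau_2]$ iff both are in the unary relation (at $\theta_1$, $\theta_2$) and for all $W'\sqsupseteq W$, $m'<m$, $(v_1,v_2,W',m')\in V[\tau_1]$ and $\Sigma_1\approx_{\mathcal A}\Sigma_2$ containing $\Sigma$: $([v_1/x]e_1,[v_2/x]e_2,W',\Sigma_1,\Sigma_2,m')\in E[\tau_2]$. States: $(S_1,S_2,m)\triangleright W$ iff $\theta_i\subseteq\theta_{S_i}$, $\beta\subseteq\mathrm{dom}\,\theta_1\times\mathrm{dom}\,\theta_2$, and for $(l_1,l_2)\in\beta$: $\theta_1(l_1)=\theta_2(l_2)$ and $(S_1(l_1),S_2(l_2),W,m)\in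 V[\theta_1(l_1)]$. Observations are *indistinguishable*, $\omega\simeq_{W,m}\omega'$, iff both are invisible, or they are equal and not writes, or they are $l_\tau(v)$, $l'_\tau(v')$ with $(v,v',W,m)\in V[\tau]$ and $(l,l')\in\beta$. They are *irrelevant*, $\omega\equiv_{W,m}\omega'$, iff at least one is invisible, or they are equal and not writes, or they are $l_\tau(v)$, $l'_\tau(v')$ with $(v,v',W,m)\in V[\tau]$. Both are lifted to traces (lists of observations) pointwise. Irrelevance is implied by indistinguishability. $(e_1,e_2,W,\Sigma,\Sigma',m)\in E[\tau]$ iff $(e_1,e_2,W,m)\in V[\tau]$, or $\Sigma\approx_{\mathcal A}\Sigma'$ and for all $\Sigma_1\supseteq\Sigma$, $\Sigma_2\supseteq\Sigma'$ with $\Sigma_1\approx_{\mathcal A}\Sigma_2$, all $W'\sqsupseteq W$, $m'<m$ and $(S_1,S_2,m')\triangleright W'$, one of the following holds: (Par) neither $e_i$ is a value, and for all steps $e_i,\Sigma_i,S_i\to e_i',S_i',\omega_i,\Sigma_i'$ ($i=1,2$) such that $\omega_1\equiv_{W',m'}\omega_2$ or $\Sigma_1'\sqsubseteq\mathcal A$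 or $\Sigma_2'\sqsubseteq\mathcal A$, there is $W''\sqsupseteq W'$ with $(S_1',S_2',m')\triangleright W''$, $\omega_1\simeq_{W'',m'}\omega_2$ and $(e_1',e_2',W'',\Sigma,\Sigma',m')\in E[\tau]$; (L) $e_1$ is not a value, and for every step $e_1,\Sigma_1,S_1\to e_1',S_1',\omega,\Sigma_1'$, $\omega$ is invisible and there is $W''\sqsupseteq W'$ with $(S_1',S_2,m')\triangleright W''$ and $(e_1',e_2,W'',\Sigma,\Sigma',m')\in E[\tau]$; (R) the mirror image of (L) for $e_2$. **Flow-Lock security.** $S|_{\mathcal A}$ is the restriction of $S$ to locations of visible type; $L$ is *$\mathcal A$-low* if $L|_{\mathcal A}=L$. $S_1\approx_{\mathcal A}S_2$ iff $\mathrm{dom}\,S_1|_{\mathcal A}=\mathrm{dom}\,S_2|_{\mathcal A}$ and $(S_1|_{\mathcal A},S_2|_{\mathcal A},m)\triangleright(\theta_{S_1|_{\mathcal A}},\theta_{S_2|_{\mathcal A}},\mathrm{id}_{\mathrm{dom}\,S_1|_{\mathcal A}})$ for all $m$. Write $e,S,\Sigma\Downarrow^{\Omega}e',S',\Sigma'$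 if $e$ reduces in finitely many steps (with open locks $\Sigma$) from $S$ to $e',S'$, $\Omega$ is the list of visible observations, and $\Sigma'$ is the active lock set of the last visible step. Let $$\mathit{Run}_{\mathcal A}(e,L,\Sigma,\theta)=\{(\Omega;\Sigma')\mid\exists S,S',e'.\ S\vdash\theta^L,\ S\approx_{\mathcal A}L,\ e,S,\Sigma\Downarrow^{\Omega}e',S',\Sigma'\},$$ $$\mathit{Know}_{\mathcal A}(e,\Omega,L,\Sigma)=\{S\mid S\approx_{\mathcal A}L,\ \exists\,\Omega',e',S',\Sigma'.\ e,S,\Sigma\Downarrow^{\Omega'}e',S',\Sigma',\ \exists W\sqsupseteq(\theta_L,\theta_S,\mathrm{id}_{\mathrm{dom}\,L}).\ \forall m.\ \Omega\simeq_{W,m}\Omega'\}.$$ The program $e$ *uses no higher-order state* (with respect to $\theta^L$) if every type $\tau$ in a subexpression $\mathsf{new}(e',\tau)$ of $e$ contains no function type, and every location occurring in $e$ is in $\mathrm{dom}\,\theta^L$ and its type there contains no function type. **Theorem (Our security implies Flow-Lock security).** Let $\mathcal A$ be an attacker, $\theta$ a state environment, $L$ an $\mathcal A$-low state, $\Sigma$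 a lock set, $\tau$ a type, and $e$ a program that uses no higher-order state. Suppose $(e,e,(\theta^L,\theta^L,\mathrm{id}_{\mathrm{dom}\,\theta^L}),\Sigma,\Sigma,m)\in E[\tau]$ for all step indices $m$. Then $e$ is termination-insensitively Flow-Lock secure: for all $(\Omega,\omega;\Sigma')$ and $(\Omega',\omega';\Sigma'')$ in $\mathit{Run}_{\mathcal A}(e,L,\Sigma,\theta)$ such that $\Omega\equiv_{(\theta,\theta,\mathrm{id}_{\mathrm{dom}\,\theta}),m}\Omega'$ for all $m$, and $\Sigma'\sqsubseteq\mathcal A$ or $\Sigma''\sqsubseteq\mathcal A$, $$\mathit{Know}_{\mathcal A}(e,(\Omega,\omega),L,\Sigma)=\mathit{Know}_{\mathcal A}(e,(\Omega',\omega'),L,\Sigma).$$ -/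

import Mathlib

namespace WHR

universe u v

/-! ## Policies and attackers -/

/-- A clause `K ⇒ a`: a set of locks together with an actor. -/
abbrev Clause (Lock : Type u) (Actor : Type v) := Set Lock × Actor

/-- A policy is a set of clauses. -/
abbrev Policy (Lock : Type u) (Actor : Type v) := Set (Clause Lock Actor)

section Policies
variable {Lock : Type u} {Actor : Type v}

/-- `P` flows to `Q`: every clause of `Q` has a less restrictive clause in `P`. -/
def Policy.Le (P Q : Policy Lock Actor) : Prop :=
  ∀ c ∈ Q, ∃ c' ∈ P, c'.2 = c.2 ∧ c'.1 ⊆ c.1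

/-- The least restrictive policy. -/
def Policy.bottom : Policy Lock Actor := {c | c.1 = ∅}

/-- The most restrictive policy. -/
def Policy.top : Policy Lock Actor := ∅

def Policy.join (P Q : Policy Lock Actor) : Policy Lock Actor :=
  {c | ∃ K₁ K₂, (K₁, c.2) ∈ P ∧ (K₂, c.2) ∈ Q ∧ c.1 = K₁ ∪ K₂}

/-- Specialization of a policy to a set of open locks. -/
def Policy.specialize (P : Policy Lock Actor) (K : Set Lock) : Policy Lock Actor :=
  {c | ∃ K₁, (K₁, c.2) ∈ P ∧ c.1 = K₁ \ K}

end Policies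

/-- An attacker: an actor with a capability (the locks it can open by force). -/
structure Attacker (Lock : Type u) (Actor : Type v) where
  actor : Actor
  locks : Set Lock

section Attackers
variable {Lock : Type u} {Actor : Type v}

/-- `P ⊑ A`: the policy `P` is visible to the attacker, that is, `P` flows to `{A.locks ⇒ A.actor}`. -/
def Attacker.Sees (A : Attacker Lock Actor) (P : Policy Lock Actor) : Prop :=
  Policy.Le P {(A.locks, A.actor)}

/-- `K ⊑ A`: the lock set `K` is contained in the capability of the attacker. -/
def Attacker.Covers (A : Attacker Lock Actor) (K : Set Lock) : Prop := K ⊆ A.locks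

/-- The locks of `K` that are visible to the attacker. -/
def lowLocks (A : Attacker Lock Actor) (LP : Lock → Policy Lock Actor) (K : Set Lock) : Set Lock :=
  {k | k ∈ K ∧ A.Sees (LP k)}

/-- Low equivalence of lock sets. -/
def LocksEquiv (A : Attacker Lock Actor) (LP : Lock → Policy Lock Actor) (K K' : Set Lock) : Prop :=
  lowLocks A LP K = lowLocks A LP K'

end Attackers

/-! ## Types -/

mutual
/-- Types. -/
inductive RawTy (Lock : Type u) (Actor : Type v) : Type (max u v)
  | unit : RawTy Lock Actor
  | nat : RawTy Lock Actor
  | sum : Ty Lock Actor → Ty Lock Actor → RawTy Lock Actor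
  | prod : Ty Lock Actor → Ty Lock Actor → RawTy Lock Actor
  | ref : Ty Lock Actor → RawTy Lock Actor
  | arrow : Set Lock → Policy Lock Actor → Ty Lock Actor → Ty Lock Actor → RawTy Lock Actor
/-- Annotated types: a type together with a policy. -/
inductive Ty (Lock : Type u) (Actor : Type v) : Type (max u v)
  | ann : RawTy Lock Actor → Policy Lock Actor → Ty Lock Actor
end

section Types
variable {Lock : Type u} {Actor : Type v}

def Ty.pol : Ty Lock Actor → Policy Lock Actor
  | .ann _ P => P

def Ty.specialize : Ty Lock Actor → Set Lock → Ty Lock Actor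
  | .ann a P, K => .ann a (P.specialize K)

mutual
/-- No function type occurs anywhere in the type. -/
def RawTy.ArrowFree : RawTy Lock Actor → Prop
  | .unit => True
  | .nat => True
  | .sum τ₁ τ₂ => τ₁.ArrowFree ∧ τ₂.ArrowFree
  | .prod τ₁ τ₂ => τ₁.ArrowFree ∧ τ₂.ArrowFree
  | .ref τ => τ.ArrowFree
  | .arrow _ _ _ _ => False
/-- No function type occurs anywhere in the annotated type. -/
def Ty.ArrowFree : Ty Lock Actor → Prop
  | .ann a _ => a.ArrowFree
end

mutual
/-- Subtyping on types. -/
inductive RawSub : RawTy Lock Actor → RawTy Lock Actor → Prop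
  | unit : RawSub .unit .unit
  | nat : RawSub .nat .nat
  | ref (τ : Ty Lock Actor) : RawSub (.ref τ) (.ref τ)
  | prod {τ₀ τ₁ τ₂ τ₃ : Ty Lock Actor} : Sub τ₀ τ₁ → Sub τ₂ τ₃ →
      RawSub (.prod τ₀ τ₂) (.prod τ₁ τ₃)
  | sum {τ₀ τ₁ τ₂ τ₃ : Ty Lock Actor} : Sub τ₀ τ₁ → Sub τ₂ τ₃ →
      RawSub (.sum τ₀ τ₂) (.sum τ₁ τ₃)
  | arrow {τ₀ τ₁ τ₂ τ₃ : Ty Lock Actor} {P P' : Policy Lock Actor} {K K' : Set Lock} :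
      Sub τ₀ τ₁ → Sub τ₂ τ₃ → Policy.Le P' P → K ⊆ K' →
      RawSub (.arrow K P τ₁ τ₂) (.arrow K' P' τ₀ τ₃)
/-- Subtyping on annotated types. -/
inductive Sub : Ty Lock Actor → Ty Lock Actor → Prop
  | policy {a b : RawTy Lock Actor} {P P' : Policy Lock Actor} :
      Policy.Le P P' → RawSub a b → Sub (.ann a P) (.ann b P')
end

end Types

/-! ## Expressions (variables are de Bruijn indices) -/

/-- Memory locations: a countably infinite set. -/
abbrev Loc := ℕ

inductive Expr (Lock : Type u) (Actor : Type v) : Type (max u v)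
  | var : ℕ → Expr Lock Actor
  | unit : Expr Lock Actor
  | nat : ℕ → Expr Lock Actor
  /-- `lam e` binds index `0` in `e`. -/
  | lam : Expr Lock Actor → Expr Lock Actor
  | pair : Expr Lock Actor → Expr Lock Actor → Expr Lock Actor
  | fst : Expr Lock Actor → Expr Lock Actor
  | snd : Expr Lock Actor → Expr Lock Actor
  | inl : Expr Lock Actor → Expr Lock Actor
  | inr : Expr Lock Actor → Expr Lock Actor
  /-- `case e e₁ e₂` binds index `0` in `e₁` and in `e₂`. -/
  | case : Expr Lock Actor → Expr Lock Actor → Expr Lock Actor → Expr Lock Actor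
  | app : Expr Lock Actor → Expr Lock Actor → Expr Lock Actor
  | new : Expr Lock Actor → Ty Lock Actor → Expr Lock Actor
  | deref : Expr Lock Actor → Expr Lock Actor
  | assign : Expr Lock Actor → Expr Lock Actor → Expr Lock Actor
  | openLock : Lock → Expr Lock Actor → Expr Lock Actor
  | openedLock : Lock → Expr Lock Actor → Expr Lock Actor
  | closeLock : Lock → Expr Lock Actor → Expr Lock Actor
  | closedLock : Lock → Expr Lock Actor → Expr Lock Actor
  | whenLock : Lock → Expr Lock Actor → Expr Lock Actor → Expr Lock Actor
  | loc : Loc → Expr Lock Actor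

section Expressions
variable {Lock : Type u} {Actor : Type v}

/-- Values. -/
inductive IsValue : Expr Lock Actor → Prop
  | lam (e : Expr Lock Actor) : IsValue (.lam e)
  | pair {v v' : Expr Lock Actor} : IsValue v → IsValue v' → IsValue (.pair v v')
  | inl {v : Expr Lock Actor} : IsValue v → IsValue (.inl v)
  | inr {v : Expr Lock Actor} : IsValue v → IsValue (.inr v)
  | unit : IsValue .unit
  | loc (l : Loc) : IsValue (.loc l)
  | nat (n : ℕ) : IsValue (.nat n)

/-- Lifting of a renaming under a binder. -/
def liftRen (ρ : ℕ → ℕ) : ℕ → ℕ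
  | 0 => 0
  | n + 1 => ρ n + 1

def Expr.rename : Expr Lock Actor → (ℕ → ℕ) → Expr Lock Actor
  | .var n, ρ => .var (ρ n)
  | .unit, _ => .unit
  | .nat n, _ => .nat n
  | .lam e, ρ => .lam (e.rename (liftRen ρ))
  | .pair e e', ρ => .pair (e.rename ρ) (e'.rename ρ)
  | .fst e, ρ => .fst (e.rename ρ)
  | .snd e, ρ => .snd (e.rename ρ)
  | .inl e, ρ => .inl (e.rename ρ)
  | .inr e, ρ => .inr (e.rename ρ)
  | .case e e₁ e₂, ρ => .case (e.rename ρ) (e₁.rename (liftRen ρ)) (e₂.rename (liftRen ρ))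
  | .app e e', ρ => .app (e.rename ρ) (e'.rename ρ)
  | .new e τ, ρ => .new (e.rename ρ) τ
  | .deref e, ρ => .deref (e.rename ρ)
  | .assign e e', ρ => .assign (e.rename ρ) (e'.rename ρ)
  | .openLock k e, ρ => .openLock k (e.rename ρ)
  | .openedLock k e, ρ => .openedLock k (e.rename ρ)
  | .closeLock k e, ρ => .closeLock k (e.rename ρ)
  | .closedLock k e, ρ => .closedLock k (e.rename ρ)
  | .whenLock k e e', ρ => .whenLock k (e.rename ρ) (e'.rename ρ)
  | .loc l, _ => .loc l

/-- Lifting of a substitution under a binder. -/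
def liftSub (s : ℕ → Expr Lock Actor) : ℕ → Expr Lock Actor
  | 0 => .var 0
  | n + 1 => (s n).rename Nat.succ

def Expr.subst : Expr Lock Actor → (ℕ → Expr Lock Actor) → Expr Lock Actor
  | .var n, s => s n
  | .unit, _ => .unit
  | .nat n, _ => .nat n
  | .lam e, s => .lam (e.subst (liftSub s))
  | .pair e e', s => .pair (e.subst s) (e'.subst s)
  | .fst e, s => .fst (e.subst s)
  | .snd e, s => .snd (e.subst s)
  | .inl e, s => .inl (e.subst s)
  | .inr e, s => .inr (e.subst s)
  | .case e e₁ e₂, s => .case (e.subst s) (e₁.subst (liftSub s)) (e₂.subst (liftSub s))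
  | .app e e', s => .app (e.subst s) (e'.subst s)
  | .new e τ, s => .new (e.subst s) τ
  | .deref e, s => .deref (e.subst s)
  | .assign e e', s => .assign (e.subst s) (e'.subst s)
  | .openLock k e, s => .openLock k (e.subst s)
  | .openedLock k e, s => .openedLock k (e.subst s)
  | .closeLock k e, s => .closeLock k (e.subst s)
  | .closedLock k e, s => .closedLock k (e.subst s)
  | .whenLock k e e', s => .whenLock k (e.subst s) (e'.subst s)
  | .loc l, _ => .loc l

/-- `[v/x]e` for the variable `x` of index `0`. -/
def Expr.inst (e v : Expr Lock Actor) : Expr Lock Actor :=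
  e.subst fun n => match n with
    | 0 => v
    | n + 1 => .var n

end Expressions

/-! ## State environments and states -/

/-- A state environment: a partial map from locations to types. -/
abbrev StateEnv (Lock : Type u) (Actor : Type v) := Loc → Option (Ty Lock Actor)

/-- A state maps finitely many locations to a value and a type. -/
structure State (Lock : Type u) (Actor : Type v) where
  get : Loc → Option (Expr Lock Actor × Ty Lock Actor)
  finite_dom : {l | (get l).isSome}.Finite
  isValue : ∀ l p, get l = some p → IsValue p.1

section States
variable {Lock : Type u} {Actor : Type v}

/-- `θ ⊆ θ'`, that is, `θ'` is a future of `θ`. -/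
def StateEnv.Le (θ θ' : StateEnv Lock Actor) : Prop :=
  ∀ l τ, θ l = some τ → θ' l = some τ

def StateEnv.dom (θ : StateEnv Lock Actor) : Set Loc := {l | (θ l).isSome}

def State.dom (S : State Lock Actor) : Set Loc := {l | (S.get l).isSome}

/-- The value stored at a location. -/
def State.val (S : State Lock Actor) (l : Loc) : Option (Expr Lock Actor) :=
  (S.get l).map Prod.fst

/-- The state environment of a state: the type stored at a location. -/
def State.env (S : State Lock Actor) : StateEnv Lock Actor :=
  fun l => (S.get l).map Prod.snd

/-- `S[l ↦ (v, τ)]`. -/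
def State.update (S : State Lock Actor) (l : Loc) (v : Expr Lock Actor) (τ : Ty Lock Actor)
    (hv : IsValue v) : State Lock Actor where
  get := Function.update S.get l (some (v, τ))
  finite_dom := by
    refine (S.finite_dom.insert l).subset ?_
    intro l' h
    by_cases hl : l' = l
    · exact Or.inl hl
    · refine Or.inr ?_
      simpa [Function.update_of_ne hl] using h
  isValue := by
    intro l' p h
    by_cases hl : l' = l
    · subst hl
      simp only [Function.update_self, Option.some.injEq] at h
      rw [← h]
      exact hv
    · rw [Function.update_of_ne hl] at h
      exact S.isValue l' p h

open Classical in
/-- The part of a state that the attacker can see. -/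
noncomputable def State.low (A : Attacker Lock Actor) (S : State Lock Actor) :
    State Lock Actor where
  get := fun l => (S.get l).filter fun p => decide (A.Sees p.2.pol)
  finite_dom := by
    refine S.finite_dom.subset ?_
    intro l h
    cases hg : S.get l with
    | none => simp [hg] at h
    | some p => simp [hg]
  isValue := by
    intro l p h
    exact S.isValue l p (Option.filter_eq_some_iff.mp h).1

/-- A state is low if all of its locations are visible to the attacker. -/
def State.IsLow (A : Attacker Lock Actor) (L : State Lock Actor) : Prop := L.low A = L

/-- The extension of `θ` by the types of the locations of `S` outside of its domain. -/
def StateEnv.extend (θ : StateEnv Lock Actor) (S : State Lock Actor) : StateEnv Lock Actor :=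
  fun l => match θ l with
    | some τ => some τ
    | none => S.env l

end States

/-! ## Observations and small-step reduction -/

inductive Obs (Lock : Type u) (Actor : Type v) : Type (max u v)
  | empty : Obs Lock Actor
  | write : Loc → Ty Lock Actor → Expr Lock Actor → Obs Lock Actor
  | opened : Lock → Obs Lock Actor
  | closed : Lock → Obs Lock Actor
  | unopened : Lock → Obs Lock Actor
  | unclosed : Lock → Obs Lock Actor

section Reduction
variable {Lock : Type u} {Actor : Type v}

/-- The policy of an observation; undefined (`none`) for the empty observation. -/
def Obs.policy (LP : Lock → Policy Lock Actor) : Obs Lock Actor → Option (Policy Lock Actor)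
  | .empty => none
  | .write _ τ _ => some τ.pol
  | .opened k => some (LP k)
  | .closed k => some (LP k)
  | .unopened k => some (LP k)
  | .unclosed k => some (LP k)

/-- The policy of the observation is defined and visible to the attacker. -/
def Obs.Visible (A : Attacker Lock Actor) (LP : Lock → Policy Lock Actor)
    (ω : Obs Lock Actor) : Prop :=
  ∃ P, ω.policy LP = some P ∧ A.Sees P

def Obs.IsWrite : Obs Lock Actor → Prop
  | .write _ _ _ => True
  | _ => False

/-- `Step e K S e' S' ω K'`: with open locks `K` and state `S`, the expression `e` steps to `e'` with
new state `S'`, observation `ω` and active lock set `K'`. -/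
inductive Step : Expr Lock Actor → Set Lock → State Lock Actor →
    Expr Lock Actor → State Lock Actor → Obs Lock Actor → Set Lock → Prop
  | openLock {k e K S} : Step (.openLock k e) K S (.openedLock k e) S (.opened k) K
  | opened {k e K S e' S' ω K'} : Step e (K ∪ {k}) S e' S' ω K' →
      Step (.openedLock k e) K S (.openedLock k e') S' ω K'
  | openedBeta {k v K S} : IsValue v → Step (.openedLock k v) K S v S (.unopened k) K
  | closeLock {k e K S} : Step (.closeLock k e) K S (.closedLock k e) S (.closed k) K
  | closed {k e K S e' S' ω K'} : Step e (K \ {k}) S e' S' ω K' →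
      Step (.closedLock k e) K S (.closedLock k e') S' ω K'
  | closedBeta {k v K S} : IsValue v → Step (.closedLock k v) K S v S (.unclosed k) K
  | deref {e K S e' S' ω K'} : Step e K S e' S' ω K' →
      Step (.deref e) K S (.deref e') S' ω K'
  | derefBeta {l v K S} : S.val l = some v → Step (.deref (.loc l)) K S v S .empty K
  | new {e τ K S e' S' ω K'} : Step e K S e' S' ω K' →
      Step (.new e τ) K S (.new e' τ) S' ω K'
  | newBeta {v τ l K S} (hv : IsValue v) : l ∉ S.dom →
      Step (.new v τ) K S (.loc l) (S.update l v τ hv) (.write l τ v) K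
  | assignl {e e' K S e'' S' ω K'} : Step e K S e'' S' ω K' →
      Step (.assign e e') K S (.assign e'' e') S' ω K'
  | assignr {l e K S e' S' ω K'} : Step e K S e' S' ω K' →
      Step (.assign (.loc l) e) K S (.assign (.loc l) e') S' ω K'
  | assignBeta {l v τ K S} (hv : IsValue v) : S.env l = some τ →
      Step (.assign (.loc l) v) K S .unit (S.update l v τ hv) (.write l τ v) K
  | appl {e e' K S e'' S' ω K'} : Step e K S e'' S' ω K' →
      Step (.app e e') K S (.app e'' e') S' ω K'
  | appr {e e' K S e'' S' ω K'} : Step e' K S e'' S' ω K' →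
      Step (.app (.lam e) e') K S (.app (.lam e) e'') S' ω K'
  | appBeta {e v K S} : IsValue v → Step (.app (.lam e) v) K S (e.inst v) S .empty K
  | pairl {e e' K S e'' S' ω K'} : Step e K S e'' S' ω K' →
      Step (.pair e e') K S (.pair e'' e') S' ω K'
  | pairr {v e K S e' S' ω K'} : IsValue v → Step e K S e' S' ω K' →
      Step (.pair v e) K S (.pair v e') S' ω K'
  | fst {e K S e' S' ω K'} : Step e K S e' S' ω K' → Step (.fst e) K S (.fst e') S' ω K'
  | fstBeta {v v' K S} : IsValue v → IsValue v' → Step (.fst (.pair v v')) K S v S .empty K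
  | snd {e K S e' S' ω K'} : Step e K S e' S' ω K' → Step (.snd e) K S (.snd e') S' ω K'
  | sndBeta {v v' K S} : IsValue v → IsValue v' → Step (.snd (.pair v v')) K S v' S .empty K
  | inl {e K S e' S' ω K'} : Step e K S e' S' ω K' → Step (.inl e) K S (.inl e') S' ω K'
  | inr {e K S e' S' ω K'} : Step e K S e' S' ω K' → Step (.inr e) K S (.inr e') S' ω K'
  | case {e e₁ e₂ K S e' S' ω K'} : Step e K S e' S' ω K' →
      Step (.case e e₁ e₂) K S (.case e' e₁ e₂) S' ω K'
  | casel {v e₁ e₂ K S} : IsValue v → Step (.case (.inl v) e₁ e₂) K S (e₁.inst v) S .empty K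
  | caser {v e₁ e₂ K S} : IsValue v → Step (.case (.inr v) e₁ e₂) K S (e₂.inst v) S .empty K
  | whenOpen {k e e' K S e'' S' ω K'} : k ∈ K → Step e K S e'' S' ω K' →
      Step (.whenLock k e e') K S (.whenLock k e'' e') S' ω K'
  | whenClosed {k e e' K S e'' S' ω K'} : k ∉ K → Step e' K S e'' S' ω K' →
      Step (.whenLock k e e') K S (.whenLock k e e'') S' ω K'
  | whenOpenBeta {k v e' K S} : k ∈ K → IsValue v → Step (.whenLock k v e') K S v S .empty K
  | whenClosedBeta {k e v K S} : k ∉ K → IsValue v → Step (.whenLock k e v) K S v S .empty K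

/-- `Steps A LP e S K Ω e' S' K'`: several steps, where `Ω` collects the observations visible to
the attacker and `K'` is the active lock set of the last visible step. -/
inductive Steps (A : Attacker Lock Actor) (LP : Lock → Policy Lock Actor) :
    Expr Lock Actor → State Lock Actor → Set Lock → List (Obs Lock Actor) →
    Expr Lock Actor → State Lock Actor → Set Lock → Prop
  | refl {e S K} : Steps A LP e S K [] e S K
  | invisible {e S K Ω e'' S'' K' e' S' ω K''} : Steps A LP e S K Ω e'' S'' K' →
      Step e'' K S'' e' S' ω K'' → ¬ ω.Visible A LP → Steps A LP e S K Ω e' S' K'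
  | visible {e S K Ω e'' S'' K'' e' S' ω K'} : Steps A LP e S K Ω e'' S'' K'' →
      Step e'' K S'' e' S' ω K' → ω.Visible A LP → Steps A LP e S K (Ω ++ [ω]) e' S' K'

end Reduction

/-! ## Type system -/

section Typing
variable {Lock : Type u} {Actor : Type v}

/-- `Typing LP Γ K θ pc e τ`. -/
inductive Typing (LP : Lock → Policy Lock Actor) :
    List (Ty Lock Actor) → Set Lock → StateEnv Lock Actor → Policy Lock Actor →
    Expr Lock Actor → Ty Lock Actor → Prop
  | var {Γ K θ pc n τ} : Γ[n]? = some τ → Typing LP Γ K θ pc (.var n) τ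
  | unit {Γ K θ pc} : Typing LP Γ K θ pc .unit (.ann .unit Policy.bottom)
  | nat {Γ K θ pc n} : Typing LP Γ K θ pc (.nat n) (.ann .nat Policy.bottom)
  | lam {Γ K θ pc e τ₁ τ₂ K' pc'} : Typing LP (τ₁ :: Γ) K' θ pc' e τ₂ →
      Typing LP Γ K θ pc (.lam e) (.ann (.arrow K' pc' τ₁ τ₂) Policy.bottom)
  | openLock {Γ K θ pc k e τ} : Typing LP Γ (K ∪ {k}) θ pc e τ → Policy.Le pc (LP k) →
      Typing LP Γ K θ pc (.openLock k e) τ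
  | openedLock {Γ K θ pc k e τ} : Typing LP Γ (K ∪ {k}) θ pc e τ → Policy.Le pc (LP k) →
      Typing LP Γ K θ pc (.openedLock k e) τ
  | closeLock {Γ K θ pc k e τ} : Typing LP Γ (K \ {k}) θ pc e τ → Policy.Le pc (LP k) →
      Typing LP Γ K θ pc (.closeLock k e) τ
  | closedLock {Γ K θ pc k e τ} : Typing LP Γ (K \ {k}) θ pc e τ → Policy.Le pc (LP k) →
      Typing LP Γ K θ pc (.closedLock k e) τ
  | pair {Γ K θ pc e₁ e₂ τ₁ τ₂} : Typing LP Γ K θ pc e₁ τ₁ → Typing LP Γ K θ pc e₂ τ₂ →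
      Typing LP Γ K θ pc (.pair e₁ e₂) (.ann (.prod τ₁ τ₂) Policy.bottom)
  | fst {Γ K θ pc e τ₁ τ₂ P} : Typing LP Γ K θ pc e (.ann (.prod τ₁ τ₂) P) →
      Policy.Le P τ₁.pol → Typing LP Γ K θ pc (.fst e) τ₁
  | snd {Γ K θ pc e τ₁ τ₂ P} : Typing LP Γ K θ pc e (.ann (.prod τ₁ τ₂) P) →
      Policy.Le P τ₂.pol → Typing LP Γ K θ pc (.snd e) τ₂
  | inl {Γ K θ pc e τ₁ τ₂} : Typing LP Γ K θ pc e τ₁ →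
      Typing LP Γ K θ pc (.inl e) (.ann (.sum τ₁ τ₂) Policy.bottom)
  | inr {Γ K θ pc e τ₁ τ₂} : Typing LP Γ K θ pc e τ₂ →
      Typing LP Γ K θ pc (.inr e) (.ann (.sum τ₁ τ₂) Policy.bottom)
  | case {Γ K θ pc e e₁ e₂ τ₁ τ₂ P τ} : Typing LP Γ K θ pc e (.ann (.sum τ₁ τ₂) P) →
      Policy.Le P τ.pol → Typing LP (τ₁ :: Γ) K θ (pc.join P) e₁ τ →
      Typing LP (τ₂ :: Γ) K θ (pc.join P) e₂ τ → Typing LP Γ K θ pc (.case e e₁ e₂) τ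
  | sub {Γ K θ pc e τ pc' τ'} : Typing LP Γ K θ pc' e τ' → Policy.Le pc pc' → Sub τ' τ →
      Typing LP Γ K θ pc e τ
  | app {Γ K θ pc e₁ e₂ τ₁ τ₂ τ₁' K' pc' P} :
      Typing LP Γ K θ pc e₁ (.ann (.arrow K' pc' τ₁ τ₂) P) → Typing LP Γ K θ pc e₂ τ₁' →
      Policy.Le P τ₂.pol → Policy.Le (pc.join P) pc' → Sub τ₁' τ₁ → K' ⊆ K →
      Typing LP Γ K θ pc (.app e₁ e₂) τ₂
  | deref {Γ K θ pc e τ τ' P} : Typing LP Γ K θ pc e (.ann (.ref τ) P) → Policy.Le P τ'.pol →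
      Sub τ τ' → Typing LP Γ K θ pc (.deref e) τ'
  | new {Γ K θ pc e τ τ'} : Typing LP Γ K θ pc e τ' → Policy.Le pc τ.pol →
      Sub (τ'.specialize K) τ →
      Typing LP Γ K θ pc (.new e τ) (.ann (.ref τ) Policy.bottom)
  | loc {Γ K θ pc l τ} : θ l = some τ →
      Typing LP Γ K θ pc (.loc l) (.ann (.ref τ) Policy.bottom)
  | assign {Γ K θ pc e e' τ τ' P} : Typing LP Γ K θ pc e (.ann (.ref τ') P) →
      Sub (τ.specialize K) τ' → Typing LP Γ K θ pc e' τ → Policy.Le (pc.join P) τ'.pol →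
      Typing LP Γ K θ pc (.assign e e') (.ann .unit Policy.bottom)
  | whenLock {Γ K θ pc k e₁ e₂ τ} : Typing LP Γ (K ∪ {k}) θ (pc.join (LP k)) e₁ τ →
      Typing LP Γ K θ (pc.join (LP k)) e₂ τ → Policy.Le (LP k) τ.pol →
      Typing LP Γ K θ pc (.whenLock k e₁ e₂) τ

/-- Syntactic well-formedness of a state in a state environment. The lock set and the program
counter of the typing judgment are immaterial, because it is applied to values only. -/
def State.WellTyped (LP : Lock → Policy Lock Actor) (S : State Lock Actor)
    (θ : StateEnv Lock Actor) : Prop :=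
  ∀ l τ, θ l = some τ →
    S.env l = some τ ∧ ∃ v, S.val l = some v ∧ Typing LP [] ∅ θ Policy.top v τ

end Typing

/-! ## Unary relation -/

section Unary
variable {Lock : Type u} {Actor : Type v}

/-- Well-formedness of a state in a state environment, for a given value relation. -/
def UState (V : Ty Lock Actor → Expr Lock Actor → Prop) (S : State Lock Actor)
    (θ : StateEnv Lock Actor) : Prop :=
  ∀ l τ, θ l = some τ → S.env l = some τ ∧ ∃ v, S.val l = some v ∧ V τ v

mutual
/-- Unary expression relation: `(e, θ, m) ∈ E[τ]_pc`. -/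
def UExp (LP : Lock → Policy Lock Actor) (m : ℕ) (τ : Ty Lock Actor) (pc : Policy Lock Actor)
    (e : Expr Lock Actor) (θ : StateEnv Lock Actor) : Prop :=
  (¬ IsValue e ∧
    ∀ (S : State Lock Actor) (θ' : StateEnv Lock Actor) (m' : ℕ) (e' : Expr Lock Actor)
      (S' : State Lock Actor) (ω : Obs Lock Actor) (K K' : Set Lock),
      θ.Le θ' → ∀ _ : m' < m, UState (fun τ' v => UVal LP m' τ' v θ') S θ' →
      Step e K S e' S' ω K' →
        (ω = .empty ∨ ∃ P, ω.policy LP = some P ∧ Policy.Le pc P) ∧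
        ∃ θ'' : StateEnv Lock Actor, θ'.Le θ'' ∧
          UState (fun τ' v => UVal LP m' τ' v θ'') S' θ'' ∧ UExp LP m' τ pc e' θ'') ∨
  UVal LP m τ e θ
termination_by (m, sizeOf τ, 1)

/-- Unary value relation at annotated types. -/
def UVal (LP : Lock → Policy Lock Actor) (m : ℕ) (τ : Ty Lock Actor)
    (v : Expr Lock Actor) (θ : StateEnv Lock Actor) : Prop :=
  match τ with
  | .ann a _ => URaw LP m a v θ
termination_by (m, sizeOf τ, 0)

/-- Unary value relation at types. -/
def URaw (LP : Lock → Policy Lock Actor) (m : ℕ) (a : RawTy Lock Actor)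
    (v : Expr Lock Actor) (θ : StateEnv Lock Actor) : Prop :=
  match a with
  | .unit => v = .unit
  | .nat => ∃ n, v = .nat n
  | .prod τ₁ τ₂ => ∃ v₁ v₂, v = .pair v₁ v₂ ∧ UVal LP m τ₁ v₁ θ ∧ UVal LP m τ₂ v₂ θ
  | .sum τ₁ τ₂ => (∃ v', v = .inl v' ∧ UVal LP m τ₁ v' θ) ∨ (∃ v', v = .inr v' ∧ UVal LP m τ₂ v' θ)
  | .arrow _ pc τ₁ τ₂ => ∃ e, v = .lam e ∧
      ∀ (θ' : StateEnv Lock Actor) (v' : Expr Lock Actor) (m' : ℕ), θ.Le θ' → ∀ _ : m' < m,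
        UVal LP m' τ₁ v' θ' → UExp LP m' τ₂ pc (e.inst v') θ'
  | .ref τ => ∃ l, v = .loc l ∧ θ l = some τ
termination_by (m, sizeOf a, 0)
end

end Unary

/-! ## Worlds and the binary relation -/

/-- A world: two state environments and a partial bijection between locations. -/
structure World (Lock : Type u) (Actor : Type v) where
  env₁ : StateEnv Lock Actor
  env₂ : StateEnv Lock Actor
  bij : Loc ≃. Loc

section Binary
variable {Lock : Type u} {Actor : Type v}

/-- `W'` is a future world of `W`. -/
def World.Le (W W' : World Lock Actor) : Prop :=
  W.env₁.Le W'.env₁ ∧ W.env₂.Le W'.env₂ ∧ W.bij ≤ W'.bij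

open Classical in
/-- The identity on a set of locations, as a partial bijection. -/
noncomputable def idOn (D : Set Loc) : Loc ≃. Loc := PEquiv.ofSet D

/-- The world `(θ, θ, id)`. -/
noncomputable def World.diag (θ : StateEnv Lock Actor) : World Lock Actor := ⟨θ, θ, idOn θ.dom⟩

/-- Indistinguishability of states in a world, for a given relation between values. -/
def BState (V : Ty Lock Actor → Expr Lock Actor → Expr Lock Actor → Prop)
    (S₁ S₂ : State Lock Actor) (W : World Lock Actor) : Prop :=
  (∀ l τ, W.env₁ l = some τ → S₁.env l = some τ) ∧
  (∀ l τ, W.env₂ l = some τ → S₂.env l = some τ) ∧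
  (∀ l₁ l₂, l₂ ∈ W.bij l₁ → l₁ ∈ W.env₁.dom ∧ l₂ ∈ W.env₂.dom) ∧
  (∀ l₁ l₂, l₂ ∈ W.bij l₁ → ∃ τ v₁ v₂, W.env₁ l₁ = some τ ∧ W.env₂ l₂ = some τ ∧
    S₁.val l₁ = some v₁ ∧ S₂.val l₂ = some v₂ ∧ V τ v₁ v₂)

/-- Observational indistinguishability, for a given relation between values. -/
inductive ObsIndistWith (A : Attacker Lock Actor) (LP : Lock → Policy Lock Actor)
    (V : Ty Lock Actor → Expr Lock Actor → Expr Lock Actor → Prop) (W : World Lock Actor) :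
    Obs Lock Actor → Obs Lock Actor → Prop
  | high {ω ω'} : ¬ ω.Visible A LP → ¬ ω'.Visible A LP → ObsIndistWith A LP V W ω ω'
  | refl {ω} : ¬ ω.IsWrite → ObsIndistWith A LP V W ω ω
  | extend {τ v v' l l'} : V τ v v' → l' ∈ W.bij l →
      ObsIndistWith A LP V W (.write l τ v) (.write l' τ v')

/-- Observational irrelevance, for a given relation between values. -/
inductive ObsIrrelWith (A : Attacker Lock Actor) (LP : Lock → Policy Lock Actor)
    (V : Ty Lock Actor → Expr Lock Actor → Expr Lock Actor → Prop) :
    Obs Lock Actor → Obs Lock Actor → Prop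
  | refl {ω} : ¬ ω.IsWrite → ObsIrrelWith A LP V ω ω
  | high {ω ω'} : ¬ ω.Visible A LP ∨ ¬ ω'.Visible A LP → ObsIrrelWith A LP V ω ω'
  | extend {τ v v' l l'} : V τ v v' → ObsIrrelWith A LP V (.write l τ v) (.write l' τ v')

mutual
/-- Binary expression relation: `(e₁, e₂, W, K, K', m) ∈ E[τ]`. The three alternatives of the
reduction part are the clauses for parallel steps, left steps and right steps. -/
def BExp (A : Attacker Lock Actor) (LP : Lock → Policy Lock Actor) (m : ℕ) (τ : Ty Lock Actor)
    (e₁ e₂ : Expr Lock Actor) (W : World Lock Actor) (K K' : Set Lock) : Prop :=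
  (LocksEquiv A LP K K' ∧
    ∀ K₁ K₂ : Set Lock, K ⊆ K₁ → K' ⊆ K₂ → LocksEquiv A LP K₁ K₂ →
    ∀ (W' : World Lock Actor) (m' : ℕ) (S₁ S₂ : State Lock Actor), ∀ _ : m' < m, W.Le W' →
    BState (fun τ' v v' => BVal A LP m' τ' v v' W') S₁ S₂ W' →
      (¬ IsValue e₁ ∧ ¬ IsValue e₂ ∧
        ∀ (e₁' : Expr Lock Actor) (S₁' : State Lock Actor) (K₁' : Set Lock) (ω : Obs Lock Actor)
          (e₂' : Expr Lock Actor) (K₂' : Set Lock) (S₂' : State Lock Actor) (ω' : Obs Lock Actor),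
          Step e₁ K₁ S₁ e₁' S₁' ω K₁' → Step e₂ K₂ S₂ e₂' S₂' ω' K₂' →
          (ObsIrrelWith A LP (fun τ' v v' => BVal A LP m' τ' v v' W') ω ω' ∨
            A.Covers K₁' ∨ A.Covers K₂') →
          ∃ W'' : World Lock Actor, W'.Le W'' ∧
            BState (fun τ' v v' => BVal A LP m' τ' v v' W'') S₁' S₂' W'' ∧
            ObsIndistWith A LP (fun τ' v v' => BVal A LP m' τ' v v' W'') W'' ω ω' ∧
            BExp A LP m' τ e₁' e₂' W'' K K') ∨
      (¬ IsValue e₁ ∧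
        ∀ (e₁' : Expr Lock Actor) (S₁' : State Lock Actor) (K₁' : Set Lock) (ω : Obs Lock Actor),
          Step e₁ K₁ S₁ e₁' S₁' ω K₁' → ¬ ω.Visible A LP ∧
          ∃ W'' : World Lock Actor, W'.Le W'' ∧
            BState (fun τ' v v' => BVal A LP m' τ' v v' W'') S₁' S₂ W'' ∧
            BExp A LP m' τ e₁' e₂ W'' K K') ∨
      (¬ IsValue e₂ ∧
        ∀ (e₂' : Expr Lock Actor) (S₂' : State Lock Actor) (K₂' : Set Lock) (ω : Obs Lock Actor),
          Step e₂ K₂ S₂ e₂' S₂' ω K₂' → ¬ ω.Visible A LP ∧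
          ∃ W'' : World Lock Actor, W'.Le W'' ∧
            BState (fun τ' v v' => BVal A LP m' τ' v v' W'') S₁ S₂' W'' ∧
            BExp A LP m' τ e₁ e₂' W'' K K')) ∨
  BVal A LP m τ e₁ e₂ W
termination_by (m, sizeOf τ, 1)

/-- Binary value relation at annotated types. -/
def BVal (A : Attacker Lock Actor) (LP : Lock → Policy Lock Actor) (m : ℕ) (τ : Ty Lock Actor)
    (v v' : Expr Lock Actor) (W : World Lock Actor) : Prop :=
  match τ with
  | .ann a P => (A.Sees P ∧ BRaw A LP m a v v' W) ∨
      (¬ A.Sees P ∧ URaw LP m a v W.env₁ ∧ URaw LP m a v' W.env₂)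
termination_by (m, sizeOf τ, 0)

/-- Binary value relation at types. -/
def BRaw (A : Attacker Lock Actor) (LP : Lock → Policy Lock Actor) (m : ℕ)
    (a : RawTy Lock Actor) (v v' : Expr Lock Actor) (W : World Lock Actor) : Prop :=
  match a with
  | .unit => v = .unit ∧ v' = .unit
  | .nat => ∃ n, v = .nat n ∧ v' = .nat n
  | .prod τ₁ τ₂ => ∃ v₁ v₂ v₁' v₂', v = .pair v₁ v₂ ∧ v' = .pair v₁' v₂' ∧
      BVal A LP m τ₁ v₁ v₁' W ∧ BVal A LP m τ₂ v₂ v₂' W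
  | .sum τ₁ τ₂ => (∃ u u', v = .inl u ∧ v' = .inl u' ∧ BVal A LP m τ₁ u u' W) ∨
      (∃ u u', v = .inr u ∧ v' = .inr u' ∧ BVal A LP m τ₂ u u' W)
  | .ref τ => ∃ l l', v = .loc l ∧ v' = .loc l' ∧ W.env₁ l = some τ ∧ W.env₂ l' = some τ ∧
      l' ∈ W.bij l
  | .arrow K pc τ₁ τ₂ => ∃ e₁ e₂, v = .lam e₁ ∧ v' = .lam e₂ ∧
      (∀ W' : World Lock Actor, W.Le W' → ∀ m' : ℕ, ∀ _ : m' < m,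
        ∀ v₁ v₂ : Expr Lock Actor, BVal A LP m' τ₁ v₁ v₂ W' →
        ∀ K₁ K₂ : Set Lock, K ⊆ K₁ → K ⊆ K₂ → LocksEquiv A LP K₁ K₂ →
          BExp A LP m' τ₂ (e₁.inst v₁) (e₂.inst v₂) W' K₁ K₂) ∧
      URaw LP m (.arrow K pc τ₁ τ₂) v W.env₁ ∧ URaw LP m (.arrow K pc τ₁ τ₂) v' W.env₂
termination_by (m, sizeOf a, 0)
end

/-- `(S₁, S₂, m)` is indistinguishable in the world `W`. -/
def StateIndist (A : Attacker Lock Actor) (LP : Lock → Policy Lock Actor) (m : ℕ)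
    (S₁ S₂ : State Lock Actor) (W : World Lock Actor) : Prop :=
  BState (fun τ v v' => BVal A LP m τ v v' W) S₁ S₂ W

/-- Indistinguishability of traces: pointwise observational indistinguishability. -/
def TraceIndist (A : Attacker Lock Actor) (LP : Lock → Policy Lock Actor) (m : ℕ)
    (W : World Lock Actor) (Ω Ω' : List (Obs Lock Actor)) : Prop :=
  List.Forall₂ (ObsIndistWith A LP (fun τ v v' => BVal A LP m τ v v' W) W) Ω Ω'

/-- Pointwise observational irrelevance of traces. -/
def TraceIrrel (A : Attacker Lock Actor) (LP : Lock → Policy Lock Actor) (m : ℕ)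
    (W : World Lock Actor) (Ω Ω' : List (Obs Lock Actor)) : Prop :=
  List.Forall₂ (ObsIrrelWith A LP (fun τ v v' => BVal A LP m τ v v' W)) Ω Ω'

/-! ## Flow-Lock security -/

/-- Low equivalence of states. -/
def StateEquiv (A : Attacker Lock Actor) (LP : Lock → Policy Lock Actor)
    (S₁ S₂ : State Lock Actor) : Prop :=
  (S₁.low A).dom = (S₂.low A).dom ∧
  ∀ m, StateIndist A LP m (S₁.low A) (S₂.low A)
    ⟨(S₁.low A).env, (S₂.low A).env, idOn (S₁.low A).dom⟩

/-- The knowledge of the attacker: the initial states that are compatible with the trace `Ω`. -/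
def Know (A : Attacker Lock Actor) (LP : Lock → Policy Lock Actor) (e : Expr Lock Actor)
    (Ω : List (Obs Lock Actor)) (L : State Lock Actor) (K : Set Lock) : Set (State Lock Actor) :=
  {S | StateEquiv A LP S L ∧
    ∃ (Ω' : List (Obs Lock Actor)) (e' : Expr Lock Actor) (S' : State Lock Actor) (K' : Set Lock),
      Steps A LP e S K Ω' e' S' K' ∧
      ∃ W : World Lock Actor, World.Le ⟨L.env, S.env, idOn L.dom⟩ W ∧
        ∀ m, TraceIndist A LP m W Ω Ω'}

/-- The runs of a program: visible traces with the active lock set of the last visible step. -/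
def Runs (A : Attacker Lock Actor) (LP : Lock → Policy Lock Actor) (e : Expr Lock Actor)
    (L : State Lock Actor) (K : Set Lock) (θ : StateEnv Lock Actor) :
    Set (List (Obs Lock Actor) × Set Lock) :=
  {r | ∃ (S S' : State Lock Actor) (e' : Expr Lock Actor), S.WellTyped LP (θ.extend L) ∧
    StateEquiv A LP S L ∧ Steps A LP e S K r.1 e' S' r.2}

/-- Termination-insensitive Flow-Lock security. -/
def FlowLockSecure (A : Attacker Lock Actor) (LP : Lock → Policy Lock Actor)
    (e : Expr Lock Actor) (L : State Lock Actor) (K : Set Lock) (θ : StateEnv Lock Actor) : Prop :=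
  ∀ (Ω Ω' : List (Obs Lock Actor)) (ω ω' : Obs Lock Actor) (K' K'' : Set Lock),
    (Ω ++ [ω], K') ∈ Runs A LP e L K θ → (Ω' ++ [ω'], K'') ∈ Runs A LP e L K θ →
    (∀ m, TraceIrrel A LP m (World.diag θ) Ω Ω') →
    (A.Covers K' ∨ A.Covers K'') →
    Know A LP e (Ω ++ [ω]) L K = Know A LP e (Ω' ++ [ω']) L K

/-- The expression uses no higher-order state: it allocates at function-free types only, and every
location that it mentions is one that `θ` declares to have a function-free type. -/
def Expr.NoHigherOrderState (θ : StateEnv Lock Actor) : Expr Lock Actor → Prop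
  | .var _ => True
  | .unit => True
  | .nat _ => True
  | .lam e => e.NoHigherOrderState θ
  | .pair e e' => e.NoHigherOrderState θ ∧ e'.NoHigherOrderState θ
  | .fst e => e.NoHigherOrderState θ
  | .snd e => e.NoHigherOrderState θ
  | .inl e => e.NoHigherOrderState θ
  | .inr e => e.NoHigherOrderState θ
  | .case e e₁ e₂ => e.NoHigherOrderState θ ∧ e₁.NoHigherOrderState θ ∧ e₂.NoHigherOrderState θ
  | .app e e' => e.NoHigherOrderState θ ∧ e'.NoHigherOrderState θ
  | .new e τ => e.NoHigherOrderState θ ∧ τ.ArrowFree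
  | .deref e => e.NoHigherOrderState θ
  | .assign e e' => e.NoHigherOrderState θ ∧ e'.NoHigherOrderState θ
  | .openLock _ e => e.NoHigherOrderState θ
  | .openedLock _ e => e.NoHigherOrderState θ
  | .closeLock _ e => e.NoHigherOrderState θ
  | .closedLock _ e => e.NoHigherOrderState θ
  | .whenLock _ e e' => e.NoHigherOrderState θ ∧ e'.NoHigherOrderState θ
  | .loc l => ∃ τ, θ l = some τ ∧ τ.ArrowFree

end Binary

end WHR

namespace WHR

universe u v

section Relations
variable {Lock : Type u} {Actor : Type v}

/-! ## Futures -/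

theorem StateEnv.Le.refl (θ : StateEnv Lock Actor) : θ.Le θ := fun _ _ h => h

theorem StateEnv.Le.trans {θ θ' θ'' : StateEnv Lock Actor} (h : θ.Le θ') (h' : θ'.Le θ'') :
    θ.Le θ'' := fun l τ hl => h' l τ (h l τ hl)

theorem World.Le.refl (W : World Lock Actor) : W.Le W :=
  ⟨.refl _, .refl _, le_refl _⟩

theorem World.Le.trans {W W' W'' : World Lock Actor} (h : W.Le W') (h' : W'.Le W'') :
    W.Le W'' := ⟨h.1.trans h'.1, h.2.1.trans h'.2.1, h.2.2.trans h'.2.2⟩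

theorem mem_idOn {D : Set Loc} {l l' : Loc} : l' ∈ idOn D l ↔ l = l' ∧ l ∈ D := by
  classical
  unfold idOn
  rw [PEquiv.mem_ofSet_iff]
  exact ⟨fun h => ⟨h.1.symm, h.1 ▸ h.2⟩, fun h => ⟨h.1.symm, h.1 ▸ h.2⟩⟩

/-! ## Unfolding the value relations -/

section Unfold
variable {LP : Lock → Policy Lock Actor} {A : Attacker Lock Actor} {m : ℕ}
  {τ τ₁ τ₂ : Ty Lock Actor} {a : RawTy Lock Actor} {P : Policy Lock Actor} {K : Set Lock}
  {e₁ e₂ v v' : Expr Lock Actor} {θ : StateEnv Lock Actor} {W : World Lock Actor}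

theorem uVal_ann : UVal LP m (.ann a P) v θ ↔ URaw LP m a v θ := by rw [UVal]

theorem uRaw_unit : URaw LP m .unit v θ ↔ v = .unit := by rw [URaw]

theorem uRaw_nat : URaw LP m .nat v θ ↔ ∃ n, v = .nat n := by rw [URaw]

theorem uRaw_prod : URaw LP m (.prod τ₁ τ₂) v θ ↔
    ∃ v₁ v₂, v = .pair v₁ v₂ ∧ UVal LP m τ₁ v₁ θ ∧ UVal LP m τ₂ v₂ θ := by rw [URaw]

theorem uRaw_sum : URaw LP m (.sum τ₁ τ₂) v θ ↔
    (∃ v', v = .inl v' ∧ UVal LP m τ₁ v' θ) ∨ (∃ v', v = .inr v' ∧ UVal LP m τ₂ v' θ) := by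
  rw [URaw]

theorem uRaw_ref : URaw LP m (.ref τ) v θ ↔ ∃ l, v = .loc l ∧ θ l = some τ := by rw [URaw]

theorem uRaw_arrow : URaw LP m (.arrow K P τ₁ τ₂) v θ ↔ ∃ e, v = .lam e ∧
    ∀ (θ' : StateEnv Lock Actor) (v' : Expr Lock Actor) (m' : ℕ), θ.Le θ' → ∀ _ : m' < m,
      UVal LP m' τ₁ v' θ' → UExp LP m' τ₂ P (e.inst v') θ' := by rw [URaw]

theorem bVal_ann : BVal A LP m (.ann a P) v v' W ↔ (A.Sees P ∧ BRaw A LP m a v v' W) ∨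
    (¬ A.Sees P ∧ URaw LP m a v W.env₁ ∧ URaw LP m a v' W.env₂) := by rw [BVal]

theorem bRaw_unit : BRaw A LP m .unit v v' W ↔ v = .unit ∧ v' = .unit := by rw [BRaw]

theorem bRaw_nat : BRaw A LP m .nat v v' W ↔ ∃ n, v = .nat n ∧ v' = .nat n := by rw [BRaw]

theorem bRaw_prod : BRaw A LP m (.prod τ₁ τ₂) v v' W ↔ ∃ v₁ v₂ v₁' v₂', v = .pair v₁ v₂ ∧
    v' = .pair v₁' v₂' ∧ BVal A LP m τ₁ v₁ v₁' W ∧ BVal A LP m τ₂ v₂ v₂' W := by rw [BRaw]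

theorem bRaw_sum : BRaw A LP m (.sum τ₁ τ₂) v v' W ↔
    (∃ u u', v = .inl u ∧ v' = .inl u' ∧ BVal A LP m τ₁ u u' W) ∨
      (∃ u u', v = .inr u ∧ v' = .inr u' ∧ BVal A LP m τ₂ u u' W) := by rw [BRaw]

theorem bRaw_ref : BRaw A LP m (.ref τ) v v' W ↔ ∃ l l', v = .loc l ∧ v' = .loc l' ∧
    W.env₁ l = some τ ∧ W.env₂ l' = some τ ∧ l' ∈ W.bij l := by rw [BRaw]

theorem bRaw_arrow : BRaw A LP m (.arrow K P τ₁ τ₂) v v' W ↔ ∃ e₁ e₂, v = .lam e₁ ∧ v' = .lam e₂ ∧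
    (∀ W' : World Lock Actor, W.Le W' → ∀ m' : ℕ, ∀ _ : m' < m,
      ∀ v₁ v₂ : Expr Lock Actor, BVal A LP m' τ₁ v₁ v₂ W' →
      ∀ K₁ K₂ : Set Lock, K ⊆ K₁ → K ⊆ K₂ → LocksEquiv A LP K₁ K₂ →
        BExp A LP m' τ₂ (e₁.inst v₁) (e₂.inst v₂) W' K₁ K₂) ∧
    URaw LP m (.arrow K P τ₁ τ₂) v W.env₁ ∧ URaw LP m (.arrow K P τ₁ τ₂) v' W.env₂ := by
  rw [BRaw]

end Unfold

/-! ## Monotonicity of the value relations -/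

section Mono
variable {LP : Lock → Policy Lock Actor} {A : Attacker Lock Actor}

mutual
-- The clause for functions already quantifies over all futures and all smaller indices, so it is
-- monotone by construction, and no monotonicity of `UExp` is needed.
theorem URaw.mono {m m' : ℕ} (hm : m' ≤ m) {θ θ' : StateEnv Lock Actor} (hθ : θ.Le θ') :
    ∀ (a : RawTy Lock Actor) {v : Expr Lock Actor}, URaw LP m a v θ → URaw LP m' a v θ'
  | .unit, _, h => uRaw_unit.2 (uRaw_unit.1 h)
  | .nat, _, h => uRaw_nat.2 (uRaw_nat.1 h)
  | .sum τ₁ τ₂, _, hv => by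
    rcases uRaw_sum.1 hv with ⟨v, rfl, h⟩ | ⟨v, rfl, h⟩
    · exact uRaw_sum.2 (.inl ⟨_, rfl, UVal.mono hm hθ τ₁ h⟩)
    · exact uRaw_sum.2 (.inr ⟨_, rfl, UVal.mono hm hθ τ₂ h⟩)
  | .prod τ₁ τ₂, _, hv => by
    obtain ⟨v₁, v₂, rfl, h₁, h₂⟩ := uRaw_prod.1 hv
    exact uRaw_prod.2 ⟨_, _, rfl, UVal.mono hm hθ τ₁ h₁, UVal.mono hm hθ τ₂ h₂⟩
  | .ref _, _, hv => by
    obtain ⟨l, rfl, h⟩ := uRaw_ref.1 hv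
    exact uRaw_ref.2 ⟨l, rfl, hθ _ _ h⟩
  | .arrow _ _ _ _, _, hv => by
    obtain ⟨e, rfl, h⟩ := uRaw_arrow.1 hv
    exact uRaw_arrow.2 ⟨e, rfl, fun θ'' v' k hle hk => h θ'' v' k (hθ.trans hle) (by omega)⟩
theorem UVal.mono {m m' : ℕ} (hm : m' ≤ m) {θ θ' : StateEnv Lock Actor} (hθ : θ.Le θ') :
    ∀ (τ : Ty Lock Actor) {v : Expr Lock Actor}, UVal LP m τ v θ → UVal LP m' τ v θ'
  | .ann a _, _, h => uVal_ann.2 (URaw.mono hm hθ a (uVal_ann.1 h))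
end

mutual
theorem BRaw.mono {m m' : ℕ} (hm : m' ≤ m) {W W' : World Lock Actor} (hW : W.Le W') :
    ∀ (a : RawTy Lock Actor) {v v' : Expr Lock Actor},
      BRaw A LP m a v v' W → BRaw A LP m' a v v' W'
  | .unit, _, _, h => bRaw_unit.2 (bRaw_unit.1 h)
  | .nat, _, _, h => bRaw_nat.2 (bRaw_nat.1 h)
  | .sum τ₁ τ₂, _, _, hv => by
    rcases bRaw_sum.1 hv with ⟨v, v', rfl, rfl, h⟩ | ⟨v, v', rfl, rfl, h⟩
    · exact bRaw_sum.2 (.inl ⟨_, _, rfl, rfl, BVal.mono hm hW τ₁ h⟩)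
    · exact bRaw_sum.2 (.inr ⟨_, _, rfl, rfl, BVal.mono hm hW τ₂ h⟩)
  | .prod τ₁ τ₂, _, _, hv => by
    obtain ⟨v₁, v₂, v₁', v₂', rfl, rfl, h₁, h₂⟩ := bRaw_prod.1 hv
    exact bRaw_prod.2 ⟨_, _, _, _, rfl, rfl, BVal.mono hm hW τ₁ h₁, BVal.mono hm hW τ₂ h₂⟩
  | .ref _, _, _, hv => by
    obtain ⟨l, l', rfl, rfl, h₁, h₂, h⟩ := bRaw_ref.1 hv
    exact bRaw_ref.2 ⟨l, l', rfl, rfl, hW.1 _ _ h₁, hW.2.1 _ _ h₂, hW.2.2 _ _ h⟩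
  | .arrow _ _ _ _, _, _, hv => by
    obtain ⟨e₁, e₂, rfl, rfl, h, h₁, h₂⟩ := bRaw_arrow.1 hv
    exact bRaw_arrow.2 ⟨e₁, e₂, rfl, rfl,
      fun W'' hle k hk => h W'' (hW.trans hle) k (by omega),
      URaw.mono hm hW.1 _ h₁, URaw.mono hm hW.2.1 _ h₂⟩
theorem BVal.mono {m m' : ℕ} (hm : m' ≤ m) {W W' : World Lock Actor} (hW : W.Le W') :
    ∀ (τ : Ty Lock Actor) {v v' : Expr Lock Actor},
      BVal A LP m τ v v' W → BVal A LP m' τ v v' W'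
  | .ann a _, _, _, hv => by
    rcases bVal_ann.1 hv with ⟨hP, h⟩ | ⟨hP, h₁, h₂⟩
    · exact bVal_ann.2 (.inl ⟨hP, BRaw.mono hm hW a h⟩)
    · exact bVal_ann.2 (.inr ⟨hP, URaw.mono hm hW.1 a h₁, URaw.mono hm hW.2.1 a h₂⟩)
end

-- Related values are values and satisfy the unary relation

mutual
theorem URaw.isValue {m : ℕ} {θ : StateEnv Lock Actor} :
    ∀ (a : RawTy Lock Actor) {v : Expr Lock Actor}, URaw LP m a v θ → IsValue v
  | .unit, _, h => by rw [uRaw_unit.1 h]; exact .unit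
  | .nat, _, hv => by obtain ⟨n, rfl⟩ := uRaw_nat.1 hv; exact .nat n
  | .sum τ₁ τ₂, _, hv => by
    rcases uRaw_sum.1 hv with ⟨v, rfl, h⟩ | ⟨v, rfl, h⟩
    · exact .inl (UVal.isValue τ₁ h)
    · exact .inr (UVal.isValue τ₂ h)
  | .prod τ₁ τ₂, _, hv => by
    obtain ⟨v₁, v₂, rfl, h₁, h₂⟩ := uRaw_prod.1 hv
    exact .pair (UVal.isValue τ₁ h₁) (UVal.isValue τ₂ h₂)
  | .ref _, _, hv => by obtain ⟨l, rfl, _⟩ := uRaw_ref.1 hv; exact .loc l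
  | .arrow _ _ _ _, _, hv => by obtain ⟨e, rfl, _⟩ := uRaw_arrow.1 hv; exact .lam e
theorem UVal.isValue {m : ℕ} {θ : StateEnv Lock Actor} :
    ∀ (τ : Ty Lock Actor) {v : Expr Lock Actor}, UVal LP m τ v θ → IsValue v
  | .ann a _, _, h => URaw.isValue a (uVal_ann.1 h)
end

mutual
-- At function types this is exactly why the binary clause carries the two unary memberships as
-- extra conjuncts.
theorem BRaw.toURaw {m : ℕ} {W : World Lock Actor} :
    ∀ (a : RawTy Lock Actor) {v v' : Expr Lock Actor}, BRaw A LP m a v v' W →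
      URaw LP m a v W.env₁ ∧ URaw LP m a v' W.env₂
  | .unit, _, _, h => ⟨uRaw_unit.2 (bRaw_unit.1 h).1, uRaw_unit.2 (bRaw_unit.1 h).2⟩
  | .nat, _, _, hv => by
    obtain ⟨n, h₁, h₂⟩ := bRaw_nat.1 hv
    exact ⟨uRaw_nat.2 ⟨n, h₁⟩, uRaw_nat.2 ⟨n, h₂⟩⟩
  | .sum τ₁ τ₂, _, _, hv => by
    rcases bRaw_sum.1 hv with ⟨v, v', rfl, rfl, h⟩ | ⟨v, v', rfl, rfl, h⟩
    · exact ⟨uRaw_sum.2 (.inl ⟨_, rfl, (BVal.toUVal τ₁ h).1⟩),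
        uRaw_sum.2 (.inl ⟨_, rfl, (BVal.toUVal τ₁ h).2⟩)⟩
    · exact ⟨uRaw_sum.2 (.inr ⟨_, rfl, (BVal.toUVal τ₂ h).1⟩),
        uRaw_sum.2 (.inr ⟨_, rfl, (BVal.toUVal τ₂ h).2⟩)⟩
  | .prod τ₁ τ₂, _, _, hv => by
    obtain ⟨v₁, v₂, v₁', v₂', rfl, rfl, h₁, h₂⟩ := bRaw_prod.1 hv
    exact ⟨uRaw_prod.2 ⟨_, _, rfl, (BVal.toUVal τ₁ h₁).1, (BVal.toUVal τ₂ h₂).1⟩,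
      uRaw_prod.2 ⟨_, _, rfl, (BVal.toUVal τ₁ h₁).2, (BVal.toUVal τ₂ h₂).2⟩⟩
  | .ref _, _, _, hv => by
    obtain ⟨l, l', rfl, rfl, h₁, h₂, h⟩ := bRaw_ref.1 hv
    exact ⟨uRaw_ref.2 ⟨l, rfl, h₁⟩, uRaw_ref.2 ⟨l', rfl, h₂⟩⟩
  | .arrow _ _ _ _, _, _, hv => by
    obtain ⟨e₁, e₂, rfl, rfl, h, h₁, h₂⟩ := bRaw_arrow.1 hv
    exact ⟨h₁, h₂⟩
theorem BVal.toUVal {m : ℕ} {W : World Lock Actor} :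
    ∀ (τ : Ty Lock Actor) {v v' : Expr Lock Actor}, BVal A LP m τ v v' W →
      UVal LP m τ v W.env₁ ∧ UVal LP m τ v' W.env₂
  | .ann a _, _, _, hv => by
    rcases bVal_ann.1 hv with ⟨hP, h⟩ | ⟨hP, h₁, h₂⟩
    · exact ⟨uVal_ann.2 (BRaw.toURaw a h).1, uVal_ann.2 (BRaw.toURaw a h).2⟩
    · exact ⟨uVal_ann.2 h₁, uVal_ann.2 h₂⟩
end

theorem BVal.isValue {m : ℕ} {W : World Lock Actor} {τ : Ty Lock Actor} {v v' : Expr Lock Actor}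
    (h : BVal A LP m τ v v' W) : IsValue v ∧ IsValue v' :=
  ⟨UVal.isValue τ (BVal.toUVal τ h).1, UVal.isValue τ (BVal.toUVal τ h).2⟩

theorem StateIndist.mono {m m' : ℕ} (hm : m' ≤ m) {S₁ S₂ : State Lock Actor}
    {W : World Lock Actor} (h : StateIndist A LP m S₁ S₂ W) : StateIndist A LP m' S₁ S₂ W := by
  obtain ⟨h₁, h₂, h₃, h₄⟩ := h
  refine ⟨h₁, h₂, h₃, fun l₁ l₂ hl => ?_⟩
  obtain ⟨τ, v₁, v₂, a, b, c, d, hV⟩ := h₄ l₁ l₂ hl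
  exact ⟨τ, v₁, v₂, a, b, c, d, BVal.mono hm (.refl W) τ hV⟩

theorem ObsIndistWith.mono {m m' : ℕ} (hm : m' ≤ m) {W W' : World Lock Actor} (hW : W.Le W')
    {ω ω' : Obs Lock Actor}
    (h : ObsIndistWith A LP (fun τ v v' => BVal A LP m τ v v' W) W ω ω') :
    ObsIndistWith A LP (fun τ v v' => BVal A LP m' τ v v' W') W' ω ω' := by
  cases h with
  | high h h' => exact .high h h'
  | refl h => exact .refl h
  | extend h h' => exact .extend (BVal.mono hm hW _ h) (hW.2.2 _ _ h')

theorem ObsIrrelWith.mono {m m' : ℕ} (hm : m' ≤ m) {W W' : World Lock Actor} (hW : W.Le W')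
    {ω ω' : Obs Lock Actor}
    (h : ObsIrrelWith A LP (fun τ v v' => BVal A LP m τ v v' W) ω ω') :
    ObsIrrelWith A LP (fun τ v v' => BVal A LP m' τ v v' W') ω ω' := by
  cases h with
  | high h => exact .high h
  | refl h => exact .refl h
  | extend h => exact .extend (BVal.mono hm hW _ h)

/-- Related writes carry the same type, hence the same policy. In the comparison of runs this
excludes pairing a visible step with an invisible one. -/
theorem ObsIndistWith.visible_iff {V : Ty Lock Actor → Expr Lock Actor → Expr Lock Actor → Prop}
    {W : World Lock Actor} {ω ω' : Obs Lock Actor} (h : ObsIndistWith A LP V W ω ω') :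
    ω.Visible A LP ↔ ω'.Visible A LP := by
  cases h with
  | high h h' => exact iff_of_false h h'
  | refl h => exact Iff.rfl
  | extend h h' => exact Iff.rfl

end Mono

/-! ## Function-free types -/

section ArrowFree
variable {LP : Lock → Policy Lock Actor} {A : Attacker Lock Actor}

mutual
-- The step index enters the relation only through the clause for functions, so without functions
-- `m` and `m'` need not be comparable.
theorem URaw.mono_of_arrowFree {m m' : ℕ} {θ θ' : StateEnv Lock Actor} (hθ : θ.Le θ') :
    ∀ (a : RawTy Lock Actor) {v : Expr Lock Actor}, a.ArrowFree →
      URaw LP m a v θ → URaw LP m' a v θ'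
  | .unit, _, _, h => uRaw_unit.2 (uRaw_unit.1 h)
  | .nat, _, _, h => uRaw_nat.2 (uRaw_nat.1 h)
  | .sum τ₁ τ₂, _, ha, hv => by
    rw [RawTy.ArrowFree] at ha
    rcases uRaw_sum.1 hv with ⟨v, rfl, h⟩ | ⟨v, rfl, h⟩
    · exact uRaw_sum.2 (.inl ⟨_, rfl, UVal.mono_of_arrowFree hθ τ₁ ha.1 h⟩)
    · exact uRaw_sum.2 (.inr ⟨_, rfl, UVal.mono_of_arrowFree hθ τ₂ ha.2 h⟩)
  | .prod τ₁ τ₂, _, ha, hv => by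
    rw [RawTy.ArrowFree] at ha
    obtain ⟨v₁, v₂, rfl, h₁, h₂⟩ := uRaw_prod.1 hv
    exact uRaw_prod.2 ⟨_, _, rfl, UVal.mono_of_arrowFree hθ τ₁ ha.1 h₁,
      UVal.mono_of_arrowFree hθ τ₂ ha.2 h₂⟩
  | .ref _, _, _, hv => by
    obtain ⟨l, rfl, h⟩ := uRaw_ref.1 hv
    exact uRaw_ref.2 ⟨l, rfl, hθ _ _ h⟩
  | .arrow _ _ _ _, _, ha, _ => by
    rw [RawTy.ArrowFree] at ha
    exact ha.elim
theorem UVal.mono_of_arrowFree {m m' : ℕ} {θ θ' : StateEnv Lock Actor} (hθ : θ.Le θ') :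
    ∀ (τ : Ty Lock Actor) {v : Expr Lock Actor}, τ.ArrowFree →
      UVal LP m τ v θ → UVal LP m' τ v θ'
  | .ann a _, _, ha, hv => by
    rw [Ty.ArrowFree] at ha
    exact uVal_ann.2 (URaw.mono_of_arrowFree hθ a ha (uVal_ann.1 hv))
end

/-- The world with the two sides exchanged. -/
def World.symm (W : World Lock Actor) : World Lock Actor := ⟨W.env₂, W.env₁, W.bij.symm⟩

mutual
theorem BRaw.symm {m : ℕ} {W : World Lock Actor} :
    ∀ (a : RawTy Lock Actor) {v v' : Expr Lock Actor}, a.ArrowFree →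
      BRaw A LP m a v v' W → BRaw A LP m a v' v W.symm
  | .unit, _, _, _, h => bRaw_unit.2 (bRaw_unit.1 h).symm
  | .nat, _, _, _, h => bRaw_nat.2 ((bRaw_nat.1 h).imp fun _ => And.symm)
  | .sum τ₁ τ₂, _, _, ha, hv => by
    rw [RawTy.ArrowFree] at ha
    rcases bRaw_sum.1 hv with ⟨v, v', rfl, rfl, h⟩ | ⟨v, v', rfl, rfl, h⟩
    · exact bRaw_sum.2 (.inl ⟨_, _, rfl, rfl, BVal.symm τ₁ ha.1 h⟩)
    · exact bRaw_sum.2 (.inr ⟨_, _, rfl, rfl, BVal.symm τ₂ ha.2 h⟩)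
  | .prod τ₁ τ₂, _, _, ha, hv => by
    rw [RawTy.ArrowFree] at ha
    obtain ⟨v₁, v₂, v₁', v₂', rfl, rfl, h₁, h₂⟩ := bRaw_prod.1 hv
    exact bRaw_prod.2 ⟨_, _, _, _, rfl, rfl, BVal.symm τ₁ ha.1 h₁, BVal.symm τ₂ ha.2 h₂⟩
  | .ref _, _, _, _, hv => by
    obtain ⟨l, l', rfl, rfl, h₁, h₂, h⟩ := bRaw_ref.1 hv
    exact bRaw_ref.2 ⟨l', l, rfl, rfl, h₂, h₁, (PEquiv.mem_iff_mem _).2 h⟩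
  | .arrow _ _ _ _, _, _, ha, _ => by
    rw [RawTy.ArrowFree] at ha
    exact ha.elim
theorem BVal.symm {m : ℕ} {W : World Lock Actor} :
    ∀ (τ : Ty Lock Actor) {v v' : Expr Lock Actor}, τ.ArrowFree →
      BVal A LP m τ v v' W → BVal A LP m τ v' v W.symm
  | .ann a _, _, _, ha, hv => by
    rw [Ty.ArrowFree] at ha
    rcases bVal_ann.1 hv with ⟨hP, h⟩ | ⟨hP, h₁, h₂⟩
    · exact bVal_ann.2 (.inl ⟨hP, BRaw.symm a ha h⟩)
    · exact bVal_ann.2 (.inr ⟨hP, h₂, h₁⟩)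
end

/-- `W` contains the composition of `W₁` with the inverse of `W₂`. -/
def World.Cospan (W₁ W₂ W : World Lock Actor) : Prop :=
  W₁.env₁.Le W.env₁ ∧ W₂.env₁.Le W.env₂ ∧
    ∀ l₁ l₂ l₀, l₀ ∈ W₁.bij l₁ → l₀ ∈ W₂.bij l₂ → l₂ ∈ W.bij l₁

mutual
-- Transitivity through a common right partner `v₀`. The three indices are unrelated, which is what
-- turns indistinguishability at one index into indistinguishability at all of them.
theorem BRaw.cospan {m m₁ m₂ : ℕ} {W W₁ W₂ : World Lock Actor} (hW : World.Cospan W₁ W₂ W) :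
    ∀ (a : RawTy Lock Actor) {v₁ v₂ v₀ : Expr Lock Actor}, a.ArrowFree →
      BRaw A LP m₁ a v₁ v₀ W₁ → BRaw A LP m₂ a v₂ v₀ W₂ → BRaw A LP m a v₁ v₂ W
  | .unit, _, _, _, _, h, h' => bRaw_unit.2 ⟨(bRaw_unit.1 h).1, (bRaw_unit.1 h').1⟩
  | .nat, _, _, _, _, hv, hv' => by
    obtain ⟨n, rfl, rfl⟩ := bRaw_nat.1 hv
    obtain ⟨n', rfl, hn⟩ := bRaw_nat.1 hv'
    cases hn
    exact bRaw_nat.2 ⟨n, rfl, rfl⟩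
  | .sum τ₁ τ₂, _, _, _, ha, hv, hv' => by
    rw [RawTy.ArrowFree] at ha
    rcases bRaw_sum.1 hv with ⟨v, v', rfl, rfl, h⟩ | ⟨v, v', rfl, rfl, h⟩
    · rcases bRaw_sum.1 hv' with ⟨u, u', rfl, hu, h'⟩ | ⟨u, u', rfl, hu, h'⟩
      · cases hu
        exact bRaw_sum.2 (.inl ⟨_, _, rfl, rfl, BVal.cospan hW τ₁ ha.1 h h'⟩)
      · cases hu
    · rcases bRaw_sum.1 hv' with ⟨u, u', rfl, hu, h'⟩ | ⟨u, u', rfl, hu, h'⟩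
      · cases hu
      · cases hu
        exact bRaw_sum.2 (.inr ⟨_, _, rfl, rfl, BVal.cospan hW τ₂ ha.2 h h'⟩)
  | .prod τ₁ τ₂, _, _, _, ha, hv, hv' => by
    rw [RawTy.ArrowFree] at ha
    obtain ⟨v₁, v₂, v₁', v₂', rfl, rfl, h₁, h₂⟩ := bRaw_prod.1 hv
    obtain ⟨u₁, u₂, u₁', u₂', rfl, hu, h₁', h₂'⟩ := bRaw_prod.1 hv'
    cases hu
    exact bRaw_prod.2 ⟨_, _, _, _, rfl, rfl, BVal.cospan hW τ₁ ha.1 h₁ h₁',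
      BVal.cospan hW τ₂ ha.2 h₂ h₂'⟩
  | .ref _, _, _, _, _, hv, hv' => by
    obtain ⟨l, l₀, rfl, rfl, h₁, h₂, h⟩ := bRaw_ref.1 hv
    obtain ⟨l', l₀', rfl, hl, h₁', h₂', h'⟩ := bRaw_ref.1 hv'
    cases hl
    exact bRaw_ref.2 ⟨l, l', rfl, rfl, hW.1 _ _ h₁, hW.2.1 _ _ h₁', hW.2.2 _ _ _ h h'⟩
  | .arrow _ _ _ _, _, _, _, ha, _, _ => by
    rw [RawTy.ArrowFree] at ha
    exact ha.elim
theorem BVal.cospan {m m₁ m₂ : ℕ} {W W₁ W₂ : World Lock Actor} (hW : World.Cospan W₁ W₂ W) :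
    ∀ (τ : Ty Lock Actor) {v₁ v₂ v₀ : Expr Lock Actor}, τ.ArrowFree →
      BVal A LP m₁ τ v₁ v₀ W₁ → BVal A LP m₂ τ v₂ v₀ W₂ → BVal A LP m τ v₁ v₂ W
  | .ann a _, _, _, _, ha, hv, hv' => by
    rw [Ty.ArrowFree] at ha
    rcases bVal_ann.1 hv with ⟨hP, h⟩ | ⟨hP, h₁, h₂⟩
    · rcases bVal_ann.1 hv' with ⟨_, h'⟩ | ⟨hP', _⟩
      · exact bVal_ann.2 (.inl ⟨hP, BRaw.cospan hW a ha h h'⟩)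
      · exact absurd hP hP'
    -- At an invisible policy nothing ties the values together; only the two unary facts have to be
    -- moved into the new world.
    · rcases bVal_ann.1 hv' with ⟨hP', _⟩ | ⟨_, h₁', _⟩
      · exact absurd hP' hP
      · exact bVal_ann.2 (.inr ⟨hP, URaw.mono_of_arrowFree hW.1 a ha h₁,
          URaw.mono_of_arrowFree hW.2.1 a ha h₁'⟩)
end

/-- The observation is not a write of a type in which a function type occurs. -/
def Obs.ArrowFree (ω : Obs Lock Actor) : Prop :=
  ∀ l τ v, ω = .write l τ v → τ.ArrowFree

theorem TraceIndist.symm {m : ℕ} {W : World Lock Actor} {Ω Ω' : List (Obs Lock Actor)}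
    (hΩ : ∀ ω ∈ Ω, ω.ArrowFree) (h : TraceIndist A LP m W Ω Ω') :
    TraceIndist A LP m W.symm Ω' Ω := by
  unfold TraceIndist at h ⊢
  induction h with
  | nil => exact .nil
  | @cons ω ω' Ω Ω' h _ ih =>
    refine .cons ?_ (ih fun ω hω => hΩ ω (by simp [hω]))
    cases h with
    | high h h' => exact .high h' h
    | refl h => exact .refl h
    | extend h h' =>
      exact .extend (BVal.symm _ (hΩ _ List.mem_cons_self _ _ _ rfl) h) ((PEquiv.mem_iff_mem _).2 h')

theorem TraceIndist.cospan {m m₁ m₂ : ℕ} {W W₁ W₂ : World Lock Actor}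
    (hW : World.Cospan W₁ W₂ W) {Ω₀ : List (Obs Lock Actor)} (hΩ₀ : ∀ ω ∈ Ω₀, ω.ArrowFree) :
    ∀ {Ω₁ Ω₂ : List (Obs Lock Actor)}, (∀ ω ∈ Ω₁, ω.Visible A LP) →
      TraceIndist A LP m₁ W₁ Ω₁ Ω₀ → TraceIndist A LP m₂ W₂ Ω₂ Ω₀ →
      TraceIndist A LP m W Ω₁ Ω₂ := by
  unfold TraceIndist
  induction Ω₀ with
  | nil =>
    rintro _ _ - ⟨⟩ ⟨⟩
    exact .nil
  | cons ω₀ Ω₀ ih =>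
    rintro _ _ hv (_ | ⟨h₁, t₁⟩) (_ | ⟨h₂, t₂⟩)
    refine .cons ?_ (ih (fun ω hω => hΩ₀ ω (by simp [hω])) (fun ω hω => hv ω (by simp [hω])) t₁ t₂)
    -- Visibility passes from the first observation to the middle one, so the clause `high` cannot
    -- occur on either side.
    have hvis := hv _ List.mem_cons_self
    have hvis₀ := h₁.visible_iff.1 hvis
    have hfree := hΩ₀ _ List.mem_cons_self
    cases h₁ with
    | high h => exact absurd hvis h
    | refl hnw =>
      cases h₂ with
      | high _ h => exact absurd hvis₀ h
      | refl h => exact .refl h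
      | extend h h' => exact absurd trivial hnw
    | extend h h' =>
      cases h₂ with
      | high _ h => exact absurd hvis₀ h
      | refl h => exact absurd trivial h
      | extend k k' => exact .extend (BVal.cospan hW _ (hfree _ _ _ rfl) h k) (hW.2.2 _ _ _ h' k')

end ArrowFree

end Relations

section Stubs
variable {Lock : Type u} {Actor : Type v}

/-! ## Stubs: values whose functions are all stuck -/

mutual
/-- `s` is a value of the type `a` in which every function has a stuck body. -/
def RawTy.Stub (θ : StateEnv Lock Actor) : RawTy Lock Actor → Expr Lock Actor → Prop
  | .unit, s => s = .unit
  | .nat, s => ∃ n, s = .nat n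
  | .sum τ₁ τ₂, s => (∃ s', s = .inl s' ∧ τ₁.Stub θ s') ∨ (∃ s', s = .inr s' ∧ τ₂.Stub θ s')
  | .prod τ₁ τ₂, s => ∃ s₁ s₂, s = .pair s₁ s₂ ∧ τ₁.Stub θ s₁ ∧ τ₂.Stub θ s₂
  | .ref τ, s => ∃ l, s = .loc l ∧ θ l = some τ
  | .arrow _ _ _ _, s => s = .lam (.app .unit .unit)
/-- `s` is a value of the annotated type `τ` in which every function has a stuck body. -/
def Ty.Stub (θ : StateEnv Lock Actor) : Ty Lock Actor → Expr Lock Actor → Prop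
  | .ann a _, s => a.Stub θ s
end

mutual
theorem RawTy.Stub.of_sub {θ : StateEnv Lock Actor} : ∀ {a b : RawTy Lock Actor}
    {s : Expr Lock Actor}, RawSub a b → a.Stub θ s → b.Stub θ s
  | _, _, _, .unit, h => h
  | _, _, _, .nat, h => h
  | _, _, _, .ref _, h => h
  | _, _, _, .prod h₁ h₂, hs => by
    simp only [RawTy.Stub] at hs ⊢
    obtain ⟨s₁, s₂, rfl, k₁, k₂⟩ := hs
    exact ⟨_, _, rfl, Ty.Stub.of_sub h₁ k₁, Ty.Stub.of_sub h₂ k₂⟩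
  | _, _, _, .sum h₁ h₂, hs => by
    simp only [RawTy.Stub] at hs ⊢
    exact hs.imp (fun ⟨s, e, k⟩ => ⟨s, e, Ty.Stub.of_sub h₁ k⟩)
      (fun ⟨s, e, k⟩ => ⟨s, e, Ty.Stub.of_sub h₂ k⟩)
  | _, _, _, .arrow _ _ _ _, h => by
    simp only [RawTy.Stub] at h ⊢
    exact h
theorem Ty.Stub.of_sub {θ : StateEnv Lock Actor} : ∀ {τ τ' : Ty Lock Actor}
    {s : Expr Lock Actor}, Sub τ τ' → τ.Stub θ s → τ'.Stub θ s
  | _, _, _, .policy _ h, hs => by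
    simp only [Ty.Stub] at hs ⊢
    exact RawTy.Stub.of_sub h hs
end

mutual
theorem RawTy.ArrowFree.of_sub : ∀ {a b : RawTy Lock Actor}, RawSub a b → b.ArrowFree → a.ArrowFree
  | _, _, .unit, h => h
  | _, _, .nat, h => h
  | _, _, .ref _, h => h
  | _, _, .prod h₁ h₂, h => by
    simp only [RawTy.ArrowFree] at h ⊢
    exact ⟨Ty.ArrowFree.of_sub h₁ h.1, Ty.ArrowFree.of_sub h₂ h.2⟩
  | _, _, .sum h₁ h₂, h => by
    simp only [RawTy.ArrowFree] at h ⊢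
    exact ⟨Ty.ArrowFree.of_sub h₁ h.1, Ty.ArrowFree.of_sub h₂ h.2⟩
  | _, _, .arrow _ _ _ _, h => by
    simp only [RawTy.ArrowFree] at h
theorem Ty.ArrowFree.of_sub : ∀ {τ τ' : Ty Lock Actor}, Sub τ τ' → τ'.ArrowFree → τ.ArrowFree
  | _, _, .policy _ h, h' => by
    simp only [Ty.ArrowFree] at h' ⊢
    exact RawTy.ArrowFree.of_sub h h'
end

theorem not_step_app_unit {e e' : Expr Lock Actor} {K K' : Set Lock} {S S' : State Lock Actor}
    {ω : Obs Lock Actor} : ¬ Step (.app .unit e) K S e' S' ω K' := by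
  intro h
  cases h with
  | appl h => cases h

theorem not_isValue_app {e e' : Expr Lock Actor} : ¬ IsValue (.app e e') := by
  intro h
  cases h

section
variable {LP : Lock → Policy Lock Actor} {A : Attacker Lock Actor} {m : ℕ}

mutual
theorem RawTy.Stub.uRaw {θ : StateEnv Lock Actor} : ∀ (a : RawTy Lock Actor)
    {s : Expr Lock Actor}, a.Stub θ s → URaw LP m a s θ
  | .unit, _, h => by
    simp only [RawTy.Stub] at h
    exact uRaw_unit.2 h
  | .nat, _, h => by
    simp only [RawTy.Stub] at h
    exact uRaw_nat.2 h
  | .sum τ₁ τ₂, _, h => by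
    simp only [RawTy.Stub] at h
    exact uRaw_sum.2 (h.imp (fun ⟨s, e, k⟩ => ⟨s, e, Ty.Stub.uVal τ₁ k⟩)
      (fun ⟨s, e, k⟩ => ⟨s, e, Ty.Stub.uVal τ₂ k⟩))
  | .prod τ₁ τ₂, _, h => by
    simp only [RawTy.Stub] at h
    obtain ⟨s₁, s₂, rfl, k₁, k₂⟩ := h
    exact uRaw_prod.2 ⟨_, _, rfl, Ty.Stub.uVal τ₁ k₁, Ty.Stub.uVal τ₂ k₂⟩
  | .ref _, _, h => by
    simp only [RawTy.Stub] at h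
    exact uRaw_ref.2 h
  | .arrow _ _ _ _, _, h => by
    simp only [RawTy.Stub] at h
    -- The body `() ()` is closed, so instantiation leaves it unchanged. It is neither a value nor
    -- able to step, and the reduction clause holds vacuously.
    refine uRaw_arrow.2 ⟨_, h, fun θ' v' m' _ _ _ => ?_⟩
    rw [UExp]
    exact .inl ⟨not_isValue_app, fun S θ' m' e' S' ω K K' _ _ _ h => (not_step_app_unit h).elim⟩
theorem Ty.Stub.uVal {θ : StateEnv Lock Actor} : ∀ (τ : Ty Lock Actor)
    {s : Expr Lock Actor}, τ.Stub θ s → UVal LP m τ s θ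
  | .ann a _, _, h => by
    simp only [Ty.Stub] at h
    exact uVal_ann.2 (RawTy.Stub.uRaw a h)
end

mutual
theorem RawTy.Stub.bRaw {θ : StateEnv Lock Actor} : ∀ (a : RawTy Lock Actor)
    {s : Expr Lock Actor}, a.Stub θ s → BRaw A LP m a s s (World.diag θ)
  | .unit, _, h => by
    simp only [RawTy.Stub] at h
    exact bRaw_unit.2 ⟨h, h⟩
  | .nat, _, h => by
    simp only [RawTy.Stub] at h
    obtain ⟨n, h⟩ := h
    exact bRaw_nat.2 ⟨n, h, h⟩
  | .sum τ₁ τ₂, _, h => by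
    simp only [RawTy.Stub] at h
    exact bRaw_sum.2 (h.imp (fun ⟨s, e, k⟩ => ⟨s, s, e, e, Ty.Stub.bVal τ₁ k⟩)
      (fun ⟨s, e, k⟩ => ⟨s, s, e, e, Ty.Stub.bVal τ₂ k⟩))
  | .prod τ₁ τ₂, _, h => by
    simp only [RawTy.Stub] at h
    obtain ⟨s₁, s₂, rfl, k₁, k₂⟩ := h
    exact bRaw_prod.2 ⟨_, _, _, _, rfl, rfl, Ty.Stub.bVal τ₁ k₁, Ty.Stub.bVal τ₂ k₂⟩
  | .ref _, _, h => by
    simp only [RawTy.Stub] at h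
    obtain ⟨l, rfl, h⟩ := h
    refine bRaw_ref.2 ⟨l, l, rfl, rfl, h, h, mem_idOn.2 ⟨rfl, ?_⟩⟩
    simp [StateEnv.dom, h]
  | .arrow K P τ₁ τ₂, s, h => by
    have hu : URaw LP m (.arrow K P τ₁ τ₂) s θ := RawTy.Stub.uRaw _ h
    simp only [RawTy.Stub] at h
    refine bRaw_arrow.2 ⟨_, _, h, h, fun W' _ m' _ v₁ v₂ _ K₁ K₂ _ _ hK => ?_, hu, hu⟩
    rw [BExp]
    -- The clause for parallel steps applies, again vacuously.
    exact .inl ⟨hK, fun _ _ _ _ _ _ _ _ _ _ _ _ => .inl ⟨not_isValue_app, not_isValue_app,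
      fun _ _ _ _ _ _ _ _ h => (not_step_app_unit h).elim⟩⟩
theorem Ty.Stub.bVal {θ : StateEnv Lock Actor} : ∀ (τ : Ty Lock Actor)
    {s : Expr Lock Actor}, τ.Stub θ s → BVal A LP m τ s s (World.diag θ)
  | .ann a P, _, h => by
    simp only [Ty.Stub] at h
    by_cases hP : A.Sees P
    · exact bVal_ann.2 (.inl ⟨hP, RawTy.Stub.bRaw a h⟩)
    · exact bVal_ann.2 (.inr ⟨hP, RawTy.Stub.uRaw a h, RawTy.Stub.uRaw a h⟩)
end

/-- A well-typed value becomes a stub of its type by making its functions stuck. -/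
theorem Typing.exists_stub {Γ : List (Ty Lock Actor)} {K : Set Lock} {θ : StateEnv Lock Actor}
    {pc : Policy Lock Actor} {v : Expr Lock Actor} {τ : Ty Lock Actor}
    (h : Typing LP Γ K θ pc v τ) (hv : IsValue v) :
    ∃ s, τ.Stub θ s ∧ (τ.ArrowFree → s = v) := by
  induction h with
  | unit => exact ⟨_, by simp only [Ty.Stub, RawTy.Stub], fun _ => rfl⟩
  | @nat Γ K θ pc n => exact ⟨.nat n, by simp [Ty.Stub, RawTy.Stub], fun _ => rfl⟩
  | lam =>
    exact ⟨.lam (.app .unit .unit), by simp only [Ty.Stub, RawTy.Stub],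
      fun h => by simp only [Ty.ArrowFree, RawTy.ArrowFree] at h⟩
  | pair _ _ ih₁ ih₂ =>
    cases hv with
    | pair hv₁ hv₂ =>
      obtain ⟨s₁, h₁, e₁⟩ := ih₁ hv₁
      obtain ⟨s₂, h₂, e₂⟩ := ih₂ hv₂
      simp only [Ty.Stub, RawTy.Stub, Ty.ArrowFree, RawTy.ArrowFree]
      exact ⟨_, ⟨_, _, rfl, h₁, h₂⟩, fun h => by rw [e₁ h.1, e₂ h.2]⟩
  | inl _ ih =>
    cases hv with
    | inl hv =>
      obtain ⟨s, h, e⟩ := ih hv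
      simp only [Ty.Stub, RawTy.Stub, Ty.ArrowFree, RawTy.ArrowFree]
      exact ⟨_, .inl ⟨_, rfl, h⟩, fun h => by rw [e h.1]⟩
  | inr _ ih =>
    cases hv with
    | inr hv =>
      obtain ⟨s, h, e⟩ := ih hv
      simp only [Ty.Stub, RawTy.Stub, Ty.ArrowFree, RawTy.ArrowFree]
      exact ⟨_, .inr ⟨_, rfl, h⟩, fun h => by rw [e h.2]⟩
  | sub _ _ hsub ih =>
    obtain ⟨s, h, e⟩ := ih hv
    exact ⟨s, h.of_sub hsub, fun h => e (h.of_sub hsub)⟩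
  | loc h =>
    simp only [Ty.Stub, RawTy.Stub]
    exact ⟨_, ⟨_, rfl, h⟩, fun _ => rfl⟩
  -- The remaining rules type expressions that are not values.
  | _ => cases hv

theorem Ty.Stub.isValue {θ : StateEnv Lock Actor} {τ : Ty Lock Actor} {s : Expr Lock Actor}
    (h : τ.Stub θ s) (LP : Lock → Policy Lock Actor) : IsValue s :=
  UVal.isValue (LP := LP) (m := 0) τ h.uVal

end

/-! ## Expressions without higher-order state -/

mutual
theorem RawTy.Stub.noHigherOrderState {θ : StateEnv Lock Actor} : ∀ (a : RawTy Lock Actor)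
    {s : Expr Lock Actor}, a.Stub θ s → a.ArrowFree → s.NoHigherOrderState θ
  | .unit, _, h, _ => by
    simp only [RawTy.Stub] at h
    subst h
    trivial
  | .nat, _, h, _ => by
    simp only [RawTy.Stub] at h
    obtain ⟨n, rfl⟩ := h
    trivial
  | .sum τ₁ τ₂, _, h, ha => by
    simp only [RawTy.Stub, RawTy.ArrowFree] at h ha
    rcases h with ⟨s, rfl, k⟩ | ⟨s, rfl, k⟩
    · have := Ty.Stub.noHigherOrderState τ₁ k ha.1
      exact this
    · have := Ty.Stub.noHigherOrderState τ₂ k ha.2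
      exact this
  | .prod τ₁ τ₂, _, h, ha => by
    simp only [RawTy.Stub, RawTy.ArrowFree] at h ha
    obtain ⟨s₁, s₂, rfl, k₁, k₂⟩ := h
    exact ⟨Ty.Stub.noHigherOrderState τ₁ k₁ ha.1, Ty.Stub.noHigherOrderState τ₂ k₂ ha.2⟩
  | .ref τ, _, h, ha => by
    simp only [RawTy.Stub, RawTy.ArrowFree] at h ha
    obtain ⟨l, rfl, h⟩ := h
    exact ⟨τ, h, ha⟩
  | .arrow _ _ _ _, _, _, ha => by
    simp only [RawTy.ArrowFree] at ha
theorem Ty.Stub.noHigherOrderState {θ : StateEnv Lock Actor} : ∀ (τ : Ty Lock Actor)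
    {s : Expr Lock Actor}, τ.Stub θ s → τ.ArrowFree → s.NoHigherOrderState θ
  | .ann a _, _, h, ha => by
    simp only [Ty.Stub, Ty.ArrowFree] at h ha
    exact RawTy.Stub.noHigherOrderState a h ha
end

theorem Expr.NoHigherOrderState.mono {θ θ' : StateEnv Lock Actor} (hθ : θ.Le θ')
    {e : Expr Lock Actor} (h : e.NoHigherOrderState θ) : e.NoHigherOrderState θ' := by
  induction e with
  | loc l => exact h.imp fun τ h => ⟨hθ _ _ h.1, h.2⟩
  | _ => simp_all [Expr.NoHigherOrderState]

theorem Expr.NoHigherOrderState.rename {θ : StateEnv Lock Actor} {e : Expr Lock Actor}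
    (h : e.NoHigherOrderState θ) (ρ : ℕ → ℕ) : (e.rename ρ).NoHigherOrderState θ := by
  induction e generalizing ρ with
  | loc l => exact h
  | _ => simp_all [Expr.NoHigherOrderState, Expr.rename]

theorem liftSub_noHigherOrderState {θ : StateEnv Lock Actor} {s : ℕ → Expr Lock Actor}
    (h : ∀ n, (s n).NoHigherOrderState θ) (n : ℕ) : (liftSub s n).NoHigherOrderState θ := by
  cases n with
  | zero => trivial
  | succ n => exact (h n).rename _

theorem Expr.NoHigherOrderState.subst {θ : StateEnv Lock Actor} {e : Expr Lock Actor}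
    (h : e.NoHigherOrderState θ) {s : ℕ → Expr Lock Actor}
    (hs : ∀ n, (s n).NoHigherOrderState θ) : (e.subst s).NoHigherOrderState θ := by
  induction e generalizing s with
  | loc l => exact h
  | _ => simp_all [Expr.NoHigherOrderState, Expr.subst, liftSub_noHigherOrderState]

theorem Expr.NoHigherOrderState.inst {θ : StateEnv Lock Actor} {e v : Expr Lock Actor}
    (h : e.NoHigherOrderState θ) (hv : v.NoHigherOrderState θ) :
    (e.inst v).NoHigherOrderState θ := by
  refine h.subst fun n => ?_
  cases n with
  | zero => exact hv
  | succ n => trivial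

/-! ## Reduction does not depend on locations of higher-order type -/

theorem State.env_update (S : State Lock Actor) (l : Loc) (v : Expr Lock Actor)
    (τ : Ty Lock Actor) (hv : IsValue v) :
    (S.update l v τ hv).env = Function.update S.env l (some τ) := by
  funext l'
  by_cases h : l' = l
  · subst h
    simp [State.env, State.update]
  · simp [State.env, State.update, h]

theorem State.val_update (S : State Lock Actor) (l : Loc) (v : Expr Lock Actor)
    (τ : Ty Lock Actor) (hv : IsValue v) :
    (S.update l v τ hv).val = Function.update S.val l (some v) := by
  funext l'
  by_cases h : l' = l
  · subst h
    simp [State.val, State.update]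
  · simp [State.val, State.update, h]

theorem State.mem_dom_iff {S : State Lock Actor} {l : Loc} : l ∈ S.dom ↔ ∃ τ, S.env l = some τ := by
  cases h : S.get l <;> simp [State.dom, State.env, h]

/-- The states `S` and `T` have the same types, extending `θ`, and agree on the locations that `θ`
declares to have a function-free type. -/
structure State.Agree (θ : StateEnv Lock Actor) (S T : State Lock Actor) : Prop where
  env_eq : S.env = T.env
  env_le : θ.Le S.env
  val_eq : ∀ l τ, θ l = some τ → τ.ArrowFree →
    ∃ v, S.val l = some v ∧ T.val l = some v ∧ v.NoHigherOrderState θ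

theorem State.Agree.update {θ : StateEnv Lock Actor} {S T : State Lock Actor}
    (h : State.Agree θ S T) {l : Loc} {v : Expr Lock Actor} {τ : Ty Lock Actor} (hv : IsValue v)
    (hl : θ l = some τ) (hvθ : v.NoHigherOrderState θ) :
    State.Agree θ (S.update l v τ hv) (T.update l v τ hv) := by
  refine ⟨?_, fun l' τ' h' => ?_, fun l' τ' h' ha => ?_⟩
  · rw [State.env_update, State.env_update, h.env_eq]
  · rw [State.env_update]
    by_cases hll : l' = l
    · subst hll
      rw [Function.update_self, ← hl, h']
    · rw [Function.update_of_ne hll]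
      exact h.env_le _ _ h'
  · rw [State.val_update, State.val_update]
    by_cases hll : l' = l
    · subst hll
      exact ⟨v, by simp, by simp, hvθ⟩
    · rw [Function.update_of_ne hll, Function.update_of_ne hll]
      exact h.val_eq l' τ' h' ha

theorem State.Agree.alloc {θ : StateEnv Lock Actor} {S T : State Lock Actor}
    (h : State.Agree θ S T) {l : Loc} {v : Expr Lock Actor} {τ : Ty Lock Actor} (hv : IsValue v)
    (hl : l ∉ S.dom) (hvθ : v.NoHigherOrderState θ) :
    θ.Le (Function.update θ l (some τ)) ∧
      State.Agree (Function.update θ l (some τ)) (S.update l v τ hv) (T.update l v τ hv) := by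
  have hθ : θ.Le (Function.update θ l (some τ)) := fun l' τ' h' => by
    have hll : l' ≠ l := fun hll => hl (State.mem_dom_iff.2 ⟨τ', hll ▸ h.env_le _ _ h'⟩)
    rw [Function.update_of_ne hll, h']
  refine ⟨hθ, ?_, fun l' τ' h' => ?_, fun l' τ' h' ha => ?_⟩
  · rw [State.env_update, State.env_update, h.env_eq]
  · rw [State.env_update]
    by_cases hll : l' = l
    · subst hll
      rwa [Function.update_self] at h' ⊢
    · rw [Function.update_of_ne hll] at h' ⊢
      exact h.env_le _ _ h'
  · rw [State.val_update, State.val_update]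
    by_cases hll : l' = l
    · subst hll
      exact ⟨v, by simp, by simp, hvθ.mono hθ⟩
    · rw [Function.update_of_ne hll] at h'
      rw [Function.update_of_ne hll, Function.update_of_ne hll]
      obtain ⟨v', h₁, h₂, h₃⟩ := h.val_eq l' τ' h' ha
      exact ⟨v', h₁, h₂, h₃.mono hθ⟩

/-- Every location met by a redex occurs in the expression, hence has a function-free type in `θ`,
where the two states agree. The environment grows only at an allocation, and a write is always at a
function-free type. -/
theorem Step.transfer {e e' : Expr Lock Actor} {K K' : Set Lock} {S S' T : State Lock Actor}
    {ω : Obs Lock Actor} {θ : StateEnv Lock Actor} (h : Step e K S e' S' ω K')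
    (he : e.NoHigherOrderState θ) (hST : State.Agree θ S T) :
    ω.ArrowFree ∧ ∃ (θ' : StateEnv Lock Actor) (T' : State Lock Actor), θ.Le θ' ∧
      Step e K T e' T' ω K' ∧ e'.NoHigherOrderState θ' ∧ State.Agree θ' S' T' := by
  have nw : ∀ {o : Obs Lock Actor}, ¬ o.IsWrite → o.ArrowFree := by
    rintro _ h l τ v rfl
    exact (h trivial).elim
  induction h with
  | openLock => exact ⟨nw id, θ, T, .refl θ, .openLock, he, hST⟩
  | closeLock => exact ⟨nw id, θ, T, .refl θ, .closeLock, he, hST⟩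
  | openedBeta hv => exact ⟨nw id, θ, T, .refl θ, .openedBeta hv, he, hST⟩
  | closedBeta hv => exact ⟨nw id, θ, T, .refl θ, .closedBeta hv, he, hST⟩
  | opened _ ih =>
    obtain ⟨ho, θ', T', hθ, hs, he', hA⟩ := ih he hST
    exact ⟨ho, θ', T', hθ, .opened hs, he', hA⟩
  | closed _ ih =>
    obtain ⟨ho, θ', T', hθ, hs, he', hA⟩ := ih he hST
    exact ⟨ho, θ', T', hθ, .closed hs, he', hA⟩
  | deref _ ih =>
    obtain ⟨ho, θ', T', hθ, hs, he', hA⟩ := ih he hST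
    exact ⟨ho, θ', T', hθ, .deref hs, he', hA⟩
  | fst _ ih =>
    obtain ⟨ho, θ', T', hθ, hs, he', hA⟩ := ih he hST
    exact ⟨ho, θ', T', hθ, .fst hs, he', hA⟩
  | snd _ ih =>
    obtain ⟨ho, θ', T', hθ, hs, he', hA⟩ := ih he hST
    exact ⟨ho, θ', T', hθ, .snd hs, he', hA⟩
  | inl _ ih =>
    obtain ⟨ho, θ', T', hθ, hs, he', hA⟩ := ih he hST
    exact ⟨ho, θ', T', hθ, .inl hs, he', hA⟩
  | inr _ ih =>
    obtain ⟨ho, θ', T', hθ, hs, he', hA⟩ := ih he hST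
    exact ⟨ho, θ', T', hθ, .inr hs, he', hA⟩
  | new _ ih =>
    obtain ⟨ho, θ', T', hθ, hs, he', hA⟩ := ih he.1 hST
    exact ⟨ho, θ', T', hθ, .new hs, ⟨he', he.2⟩, hA⟩
  | assignl _ ih =>
    obtain ⟨ho, θ', T', hθ, hs, he', hA⟩ := ih he.1 hST
    exact ⟨ho, θ', T', hθ, .assignl hs, ⟨he', he.2.mono hθ⟩, hA⟩
  | assignr _ ih =>
    obtain ⟨ho, θ', T', hθ, hs, he', hA⟩ := ih he.2 hST
    exact ⟨ho, θ', T', hθ, .assignr hs, ⟨he.1.mono hθ, he'⟩, hA⟩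
  | appl _ ih =>
    obtain ⟨ho, θ', T', hθ, hs, he', hA⟩ := ih he.1 hST
    exact ⟨ho, θ', T', hθ, .appl hs, ⟨he', he.2.mono hθ⟩, hA⟩
  | appr _ ih =>
    obtain ⟨ho, θ', T', hθ, hs, he', hA⟩ := ih he.2 hST
    exact ⟨ho, θ', T', hθ, .appr hs, ⟨he.1.mono hθ, he'⟩, hA⟩
  | pairl _ ih =>
    obtain ⟨ho, θ', T', hθ, hs, he', hA⟩ := ih he.1 hST
    exact ⟨ho, θ', T', hθ, .pairl hs, ⟨he', he.2.mono hθ⟩, hA⟩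
  | pairr hv _ ih =>
    obtain ⟨ho, θ', T', hθ, hs, he', hA⟩ := ih he.2 hST
    exact ⟨ho, θ', T', hθ, .pairr hv hs, ⟨he.1.mono hθ, he'⟩, hA⟩
  | case _ ih =>
    obtain ⟨ho, θ', T', hθ, hs, he', hA⟩ := ih he.1 hST
    exact ⟨ho, θ', T', hθ, .case hs, ⟨he', he.2.1.mono hθ, he.2.2.mono hθ⟩, hA⟩
  | whenOpen hk _ ih =>
    obtain ⟨ho, θ', T', hθ, hs, he', hA⟩ := ih he.1 hST
    exact ⟨ho, θ', T', hθ, .whenOpen hk hs, ⟨he', he.2.mono hθ⟩, hA⟩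
  | whenClosed hk _ ih =>
    obtain ⟨ho, θ', T', hθ, hs, he', hA⟩ := ih he.2 hST
    exact ⟨ho, θ', T', hθ, .whenClosed hk hs, ⟨he.1.mono hθ, he'⟩, hA⟩
  | whenOpenBeta hk hv => exact ⟨nw id, θ, T, .refl θ, .whenOpenBeta hk hv, he.1, hST⟩
  | whenClosedBeta hk hv => exact ⟨nw id, θ, T, .refl θ, .whenClosedBeta hk hv, he.2, hST⟩
  | fstBeta hv hv' => exact ⟨nw id, θ, T, .refl θ, .fstBeta hv hv', he.1, hST⟩
  | sndBeta hv hv' => exact ⟨nw id, θ, T, .refl θ, .sndBeta hv hv', he.2, hST⟩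
  | casel hv => exact ⟨nw id, θ, T, .refl θ, .casel hv, he.2.1.inst he.1, hST⟩
  | caser hv => exact ⟨nw id, θ, T, .refl θ, .caser hv, he.2.2.inst he.1, hST⟩
  | appBeta hv =>
    exact ⟨nw id, θ, T, .refl θ, .appBeta hv, Expr.NoHigherOrderState.inst he.1 he.2, hST⟩
  | derefBeta hl =>
    obtain ⟨τ, hτ, ha⟩ := he
    obtain ⟨v, h₁, h₂, h₃⟩ := hST.val_eq _ _ hτ ha
    rw [h₁] at hl
    cases hl
    exact ⟨nw id, θ, T, .refl θ, .derefBeta h₂, h₃, hST⟩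
  | @newBeta v τ l K S hv hl =>
    obtain ⟨hθ, hA⟩ := hST.alloc (τ := τ) hv hl he.1
    refine ⟨?_, _, _, hθ, .newBeta hv ?_, ⟨τ, by simp, he.2⟩, hA⟩
    · rintro _ _ _ ⟨⟩
      exact he.2
    -- The states have equal type environments, hence equal domains, so the same location is fresh
    -- in both.
    · rwa [State.mem_dom_iff, ← hST.env_eq, ← State.mem_dom_iff]
  | @assignBeta l v τ K S hv hl =>
    obtain ⟨⟨τ', hτ', ha⟩, hvθ⟩ := he
    -- The type stored in the state is the one declared by `θ`, which is function-free.
    have := hST.env_le _ _ hτ'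
    rw [hl] at this
    cases this
    refine ⟨?_, θ, _, .refl θ, .assignBeta hv (hST.env_eq ▸ hl), trivial, hST.update hv hτ' hvθ⟩
    rintro _ _ _ ⟨⟩
    exact ha

/-! ## Runs that end with a visible step -/

/-- `VisibleRun A LP K n e S Ω ω K'`: `e` takes `n` steps, the last of which is visible, with the
visible observations `Ω` followed by `ω`, and with active lock set `K'` in the last step. -/
inductive VisibleRun (A : Attacker Lock Actor) (LP : Lock → Policy Lock Actor) (K : Set Lock) :
    ℕ → Expr Lock Actor → State Lock Actor → List (Obs Lock Actor) → Obs Lock Actor →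
    Set Lock → Prop
  | last {e S e' S' ω K'} : Step e K S e' S' ω K' → ω.Visible A LP →
      VisibleRun A LP K 1 e S [] ω K'
  | invisible {n e S e' S' ω' K'' Ω ω K'} : Step e K S e' S' ω' K'' → ¬ ω'.Visible A LP →
      VisibleRun A LP K n e' S' Ω ω K' → VisibleRun A LP K (n + 1) e S Ω ω K'
  | visible {n e S e' S' ω' K'' Ω ω K'} : Step e K S e' S' ω' K'' → ω'.Visible A LP →
      VisibleRun A LP K n e' S' Ω ω K' → VisibleRun A LP K (n + 1) e S (ω' :: Ω) ω K'

section
variable {LP : Lock → Policy Lock Actor} {A : Attacker Lock Actor}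

/-- `Steps` grows at its end while `BExp` consumes a run from its beginning; this moves the steps
over one at a time. -/
theorem Steps.prepend {e e₁ : Expr Lock Actor} {S S₁ : State Lock Actor} {K K₁ : Set Lock}
    {Ω : List (Obs Lock Actor)} (h : Steps A LP e S K Ω e₁ S₁ K₁) {n : ℕ}
    {Ω' : List (Obs Lock Actor)} {ω : Obs Lock Actor} {K' : Set Lock}
    (h' : VisibleRun A LP K n e₁ S₁ Ω' ω K') : ∃ n, VisibleRun A LP K n e S (Ω ++ Ω') ω K' := by
  induction h generalizing n Ω' with
  | refl => exact ⟨n, h'⟩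
  | invisible _ hs hv ih => exact ih (.invisible hs hv h')
  | visible _ hs hv ih =>
    rw [List.append_assoc]
    exact ih (.visible hs hv h')

theorem Steps.exists_visibleRun {e e₁ : Expr Lock Actor} {S S₁ : State Lock Actor}
    {K K' : Set Lock} {Ω : List (Obs Lock Actor)} {ω : Obs Lock Actor}
    (h : Steps A LP e S K (Ω ++ [ω]) e₁ S₁ K') : ∃ n, VisibleRun A LP K n e S Ω ω K' := by
  generalize hΩ' : Ω ++ [ω] = Ω' at h
  induction h with
  | refl => simp at hΩ'
  | invisible _ hs hv ih => exact ih hΩ'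
  | visible h hs hv ih =>
    obtain ⟨rfl, hω⟩ := List.append_inj' hΩ' rfl
    cases hω
    simpa using h.prepend (.last hs hv)

theorem Steps.forall_visible {e e₁ : Expr Lock Actor} {S S₁ : State Lock Actor}
    {K K' : Set Lock} {Ω : List (Obs Lock Actor)} (h : Steps A LP e S K Ω e₁ S₁ K') :
    ∀ ω ∈ Ω, ω.Visible A LP := by
  induction h with
  | refl => simp
  | invisible _ _ _ ih => exact ih
  | visible _ _ hv ih =>
    intro ω hω
    rcases List.mem_append.1 hω with h | h
    · exact ih ω h
    · rw [List.mem_singleton.1 h]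
      exact hv

/-- The updated environment and states satisfy the invariant `State.Agree` again, so single steps
can be transferred along the whole run. -/
theorem VisibleRun.transfer {K K' : Set Lock} {n : ℕ} {e : Expr Lock Actor}
    {S T : State Lock Actor} {Ω : List (Obs Lock Actor)} {ω : Obs Lock Actor}
    {θ : StateEnv Lock Actor} (h : VisibleRun A LP K n e S Ω ω K')
    (he : e.NoHigherOrderState θ) (hST : State.Agree θ S T) :
    VisibleRun A LP K n e T Ω ω K' ∧ ∀ o ∈ Ω ++ [ω], o.ArrowFree := by
  induction h generalizing T θ with
  | last hs hv =>
    obtain ⟨ho, θ', T', -, hs', -⟩ := hs.transfer he hST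
    exact ⟨.last hs' hv, by simpa using ho⟩
  | invisible hs hv _ ih =>
    obtain ⟨-, θ', T', -, hs', he', hA⟩ := hs.transfer he hST
    exact ⟨.invisible hs' hv (ih he' hA).1, (ih he' hA).2⟩
  | visible hs hv _ ih =>
    obtain ⟨ho, θ', T', -, hs', he', hA⟩ := hs.transfer he hST
    refine ⟨.visible hs' hv (ih he' hA).1, fun o h => ?_⟩
    rcases List.mem_cons.1 h with rfl | h
    · exact ho
    · exact (ih he' hA).2 o h

theorem IsValue.not_step {v e' : Expr Lock Actor} {K K' : Set Lock} {S S' : State Lock Actor}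
    {ω : Obs Lock Actor} (hv : IsValue v) : ¬ Step v K S e' S' ω K' := by
  intro h
  induction h with
  | pairl _ ih => cases hv with | pair h _ => exact ih h
  | pairr _ _ ih => cases hv with | pair _ h => exact ih h
  | inl _ ih => cases hv with | inl h => exact ih h
  | inr _ ih => cases hv with | inr h => exact ih h
  | _ => cases hv

/-- A run starts either with a visible step or with an invisible step that leaves its trace. -/
theorem VisibleRun.exists_step {K K' : Set Lock} {n : ℕ} {e : Expr Lock Actor}
    {S : State Lock Actor} {Ω : List (Obs Lock Actor)} {ω : Obs Lock Actor}
    (h : VisibleRun A LP K n e S Ω ω K') :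
    (∃ e' S' o K'', Step e K S e' S' o K'' ∧ o.Visible A LP) ∨
      ∃ k e' S' o K'', Step e K S e' S' o K'' ∧ ¬ o.Visible A LP ∧ n = k + 1 ∧
        VisibleRun A LP K k e' S' Ω ω K' := by
  cases h with
  | last hs hv => exact .inl ⟨_, _, _, _, hs, hv⟩
  | invisible hs hv h => exact .inr ⟨_, _, _, _, _, hs, hv, rfl, h⟩
  | visible hs hv h => exact .inl ⟨_, _, _, _, hs, hv⟩

theorem VisibleRun.not_isValue {K K' : Set Lock} {n : ℕ} {e : Expr Lock Actor}
    {S : State Lock Actor} {Ω : List (Obs Lock Actor)} {ω : Obs Lock Actor}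
    (h : VisibleRun A LP K n e S Ω ω K') : ¬ IsValue e := by
  intro hv
  rcases h.exists_step with ⟨_, _, _, _, hs, -⟩ | ⟨_, _, _, _, _, hs, -⟩ <;> exact hv.not_step hs

theorem VisibleRun.pos {K K' : Set Lock} {n : ℕ} {e : Expr Lock Actor}
    {S : State Lock Actor} {Ω : List (Obs Lock Actor)} {ω : Obs Lock Actor}
    (h : VisibleRun A LP K n e S Ω ω K') : 0 < n := by
  cases h <;> omega

/-- Related expressions have indistinguishable runs in related states, if the traces of the runs
are irrelevant before the last observation and a lock set of a last step is covered. -/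
theorem BExp.exists_traceIndist {K K₁ K₂ : Set Lock} {τ : Ty Lock Actor} {W₀ : World Lock Actor}
    {ω₁ ω₂ : Obs Lock Actor} (hK : A.Covers K₁ ∨ A.Covers K₂) (N : ℕ) :
    ∀ {n₁ n₂ : ℕ} {e₁ e₂ : Expr Lock Actor} {S₁ S₂ : State Lock Actor}
      {Ω₁ Ω₂ : List (Obs Lock Actor)} {W : World Lock Actor}, n₁ + n₂ ≤ N →
      VisibleRun A LP K n₁ e₁ S₁ Ω₁ ω₁ K₁ → VisibleRun A LP K n₂ e₂ S₂ Ω₂ ω₂ K₂ →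
      W₀.Le W → (∀ m, TraceIrrel A LP m W₀ Ω₁ Ω₂) → StateIndist A LP N S₁ S₂ W →
      BExp A LP N τ e₁ e₂ W K K →
      ∃ W' : World Lock Actor, W.Le W' ∧ TraceIndist A LP 0 W' (Ω₁ ++ [ω₁]) (Ω₂ ++ [ω₂]) := by
  induction N with
  | zero =>
    intro n₁ n₂ _ _ _ _ _ _ _ hN r₁
    exact absurd r₁.pos (by omega)
  | succ N ih =>
    intro n₁ n₂ e₁ e₂ S₁ S₂ Ω₁ Ω₂ W hN r₁ r₂ hW hΩ hS hE
    rw [BExp] at hE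
    rcases hE with ⟨-, hE⟩ | hE
    -- The open locks of a run never change, so the relation is used at `K` itself. Each use lowers
    -- the index by one and shortens at least one run by one step.
    · rcases hE K K subset_rfl subset_rfl rfl W N S₁ S₂ N.lt_succ_self (.refl W)
        (hS.mono N.le_succ) with ⟨-, -, key⟩ | ⟨-, key⟩ | ⟨-, key⟩
      · cases r₁ with
        | last s₁ v₁ =>
          cases r₂ with
          | last s₂ v₂ =>
            -- Only here is the assumption on the active lock sets used: the final observations are
            -- not known to be irrelevant.
            obtain ⟨W', hWW', -, ho, -⟩ := key _ _ _ _ _ _ _ _ s₁ s₂ (.inr hK)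
            exact ⟨W', hWW', .cons (ho.mono N.zero_le (.refl W')) .nil⟩
          | invisible s₂ v₂ r₂ =>
            -- An invisible step is irrelevant to any other, so the parallel clause applies and
            -- yields indistinguishability of a visible and an invisible step, which is impossible.
            obtain ⟨W', hWW', -, ho, -⟩ := key _ _ _ _ _ _ _ _ s₁ s₂ (.inl (.high (.inr v₂)))
            exact absurd (ho.visible_iff.1 v₁) v₂
          -- Irrelevant traces have equal length, so one run cannot be at its last visible step
          -- before the other.
          | visible s₂ v₂ r₂ => cases hΩ 0
        | invisible s₁ v₁ r₁ =>
          rcases r₂.exists_step with ⟨_, _, _, _, s₂, v₂⟩ | ⟨n, _, _, _, _, s₂, v₂, rfl, r⟩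
          · obtain ⟨W', hWW', -, ho, -⟩ := key _ _ _ _ _ _ _ _ s₁ s₂ (.inl (.high (.inl v₁)))
            exact absurd (ho.visible_iff.2 v₂) v₁
          · obtain ⟨W', hWW', hS', -, hE'⟩ := key _ _ _ _ _ _ _ _ s₁ s₂ (.inl (.high (.inl v₁)))
            obtain ⟨W'', h, ht⟩ := ih (by omega) r₁ r (hW.trans hWW') hΩ hS' hE'
            exact ⟨W'', hWW'.trans h, ht⟩
        | visible s₁ v₁ r₁ =>
          cases r₂ with
          | last s₂ v₂ => cases hΩ 0
          | invisible s₂ v₂ r₂ =>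
            obtain ⟨W', hWW', -, ho, -⟩ := key _ _ _ _ _ _ _ _ s₁ s₂ (.inl (.high (.inr v₂)))
            exact absurd (ho.visible_iff.1 v₁) v₂
          | visible s₂ v₂ r₂ =>
            -- The irrelevance assumption lives in the fixed world `W₀` and is carried to the
            -- current world by monotonicity.
            obtain ⟨W', hWW', hS', ho, hE'⟩ := key _ _ _ _ _ _ _ _ s₁ s₂
              (.inl ((List.forall₂_cons.1 (hΩ N)).1.mono le_rfl hW))
            obtain ⟨W'', h, ht⟩ := ih (by omega) r₁ r₂ (hW.trans hWW')
              (fun m => (List.forall₂_cons.1 (hΩ m)).2) hS' hE'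
            exact ⟨W'', hWW'.trans h, .cons (ho.mono N.zero_le h) ht⟩
      · rcases r₁.exists_step with ⟨_, _, _, _, s₁, v₁⟩ | ⟨n, _, _, _, _, s₁, v₁, rfl, r⟩
        · exact absurd v₁ (key _ _ _ _ s₁).1
        · obtain ⟨-, W', hWW', hS', hE'⟩ := key _ _ _ _ s₁
          obtain ⟨W'', h, ht⟩ := ih (by omega) r r₂ (hW.trans hWW') hΩ hS' hE'
          exact ⟨W'', hWW'.trans h, ht⟩
      · rcases r₂.exists_step with ⟨_, _, _, _, s₂, v₂⟩ | ⟨n, _, _, _, _, s₂, v₂, rfl, r⟩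
        · exact absurd v₂ (key _ _ _ _ s₂).1
        · obtain ⟨-, W', hWW', hS', hE'⟩ := key _ _ _ _ s₂
          obtain ⟨W'', h, ht⟩ := ih (by omega) r₁ r (hW.trans hWW') hΩ hS' hE'
          exact ⟨W'', hWW'.trans h, ht⟩
    -- Related values cannot occur here, since the first run still takes a step.
    · exact absurd hE.isValue.1 r₁.not_isValue

end

end Stubs

section Security
variable {Lock : Type u} {Actor : Type v}

/-! ## Initial states -/

open Classical in
/-- The state `S` with the values at the locations of `D` replaced by those of `f`. -/
noncomputable def State.overwrite (S : State Lock Actor) (D : Set Loc) (f : Loc → Expr Lock Actor)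
    (hf : ∀ l ∈ D, IsValue (f l)) : State Lock Actor where
  get := fun l => (S.get l).map fun p => if l ∈ D then (f l, p.2) else p
  finite_dom := by simpa using S.finite_dom
  isValue := by
    intro l p h
    obtain ⟨q, hq, rfl⟩ := Option.map_eq_some_iff.1 h
    split_ifs with hl
    · exact hf l hl
    · exact S.isValue l q hq

section
variable {S : State Lock Actor} {D : Set Loc} {f : Loc → Expr Lock Actor}
  {hf : ∀ l ∈ D, IsValue (f l)} {l : Loc}

theorem State.env_overwrite : (S.overwrite D f hf).env = S.env := by
  funext l
  simp only [State.env, State.overwrite, Option.map_map]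
  congr 1
  funext p
  by_cases hl : l ∈ D <;> simp [hl]

theorem State.val_overwrite_of_mem {v : Expr Lock Actor} (hl : l ∈ D) (hv : S.val l = some v) :
    (S.overwrite D f hf).val l = some (f l) := by
  obtain ⟨p, hp, -⟩ := Option.map_eq_some_iff.1 hv
  simp [State.val, State.overwrite, hp, hl]

theorem State.val_overwrite_of_notMem (hl : l ∉ D) : (S.overwrite D f hf).val l = S.val l := by
  simp [State.val, State.overwrite, hl]

end

theorem State.get_low_eq_some {A : Attacker Lock Actor} {S : State Lock Actor} {l : Loc}
    {p : Expr Lock Actor × Ty Lock Actor} :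
    (S.low A).get l = some p ↔ S.get l = some p ∧ A.Sees p.2.pol := by
  simp [State.low, Option.filter_eq_some_iff]

theorem State.env_low_le {A : Attacker Lock Actor} {S : State Lock Actor} :
    (S.low A).env.Le S.env := fun l τ h => by
  obtain ⟨p, hp, rfl⟩ := Option.map_eq_some_iff.1 h
  exact Option.map_eq_some_iff.2 ⟨p, (State.get_low_eq_some.1 hp).1, rfl⟩

theorem State.val_eq_of_val_low {A : Attacker Lock Actor} {S : State Lock Actor} {l : Loc}
    {v : Expr Lock Actor} (h : (S.low A).val l = some v) : S.val l = some v := by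
  obtain ⟨p, hp, rfl⟩ := Option.map_eq_some_iff.1 h
  exact Option.map_eq_some_iff.2 ⟨p, (State.get_low_eq_some.1 hp).1, rfl⟩

theorem State.mem_dom_low {A : Attacker Lock Actor} {S : State Lock Actor} {l : Loc}
    {τ : Ty Lock Actor} (h : S.env l = some τ) (hτ : A.Sees τ.pol) : l ∈ (S.low A).dom := by
  obtain ⟨p, hp, rfl⟩ := Option.map_eq_some_iff.1 h
  exact Option.isSome_iff_exists.2 ⟨p, State.get_low_eq_some.2 ⟨hp, hτ⟩⟩

section
variable {LP : Lock → Policy Lock Actor} {A : Attacker Lock Actor}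

/-- On the common low domain the identity bijection relates each location to itself, which forces
equal types; off it both environments are undefined. -/
theorem StateEquiv.env_eq {S T : State Lock Actor} (h : StateEquiv A LP S T) :
    (S.low A).env = (T.low A).env := by
  funext l
  by_cases hl : l ∈ (S.low A).dom
  · obtain ⟨τ, _, _, h₁, h₂, -⟩ := (h.2 0).2.2.2 l l (mem_idOn.2 ⟨rfl, hl⟩)
    exact h₁.trans h₂.symm
  · have hl' := hl
    rw [h.1] at hl'
    simp only [State.dom, Set.mem_ofPred_eq, Bool.not_eq_true, Option.isSome_eq_false_iff,
      Option.isNone_iff_eq_none] at hl hl'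
    simp [State.env, hl, hl']

/-- If some well-typed state is equivalent to the low state `L`, then the extension of `θ` by `L`
agrees with the types of all locations of `L`. -/
theorem StateEquiv.env_le_extend {S L : State Lock Actor} {θ : StateEnv Lock Actor}
    (hL : L.IsLow A) (h : StateEquiv A LP S L) (hS : S.WellTyped LP (θ.extend L)) :
    L.env.Le (θ.extend L) := by
  intro l τ hl
  cases hθ : θ l with
  | none => simpa [StateEnv.extend, hθ] using hl
  | some τ' =>
    have hext : θ.extend L l = some τ' := by simp [StateEnv.extend, hθ]
    have henv := h.env_eq
    rw [hL] at henv
    -- The type of `l` in `L` is its type in `S`, and well-typedness makes that the type given by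
    -- `θ`. Without such an `S`, `θ` and `L` could conflict.
    have := State.env_low_le (A := A) (S := S) l τ (by rw [henv, hl])
    rw [(hS l τ' hext).1] at this
    rw [hext, this]

/-- Well-typed states that are equivalent to a low state can be changed at the locations of
higher-order type in such a way that they become indistinguishable. -/
theorem exists_agree_stateIndist {S₁ S₂ L : State Lock Actor} {θ : StateEnv Lock Actor}
    (hL : L.IsLow A) (h₁ : StateEquiv A LP S₁ L) (h₂ : StateEquiv A LP S₂ L)
    (hS₁ : S₁.WellTyped LP (θ.extend L)) (hS₂ : S₂.WellTyped LP (θ.extend L)) :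
    ∃ T₁ T₂ : State Lock Actor, State.Agree (θ.extend L) S₁ T₁ ∧ State.Agree (θ.extend L) S₂ T₂ ∧
      ∀ m, StateIndist A LP m T₁ T₂ (World.diag (θ.extend L)) := by
  classical
  have hle := h₁.env_le_extend hL hS₁
  have henv₁ := h₁.env_eq
  have henv₂ := h₂.env_eq
  have low₁ := h₁.2 0
  have low₂ := h₂.2 0
  rw [hL] at henv₁ henv₂ low₁ low₂
  set ϑ := θ.extend L
  have hstub : ∀ {S : State Lock Actor}, S.WellTyped LP ϑ → ∀ {l τ}, ϑ l = some τ →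
      ∃ s v, S.val l = some v ∧ τ.Stub ϑ s ∧ (τ.ArrowFree → s = v) := by
    intro S hS l τ hl
    obtain ⟨-, v, hv, ht⟩ := hS l τ hl
    obtain ⟨p, hp, rfl⟩ := Option.map_eq_some_iff.1 hv
    obtain ⟨s, hs, he⟩ := ht.exists_stub (S.isValue l p hp)
    exact ⟨s, p.1, hv, hs, he⟩
  have hfirst : ∀ {S : State Lock Actor}, S.WellTyped LP ϑ → ∀ {l τ}, ϑ l = some τ →
      τ.ArrowFree → ∃ v, S.val l = some v ∧ τ.Stub ϑ v := by
    intro S hS l τ hl ha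
    obtain ⟨s, v, hv, hs, he⟩ := hstub hS hl
    exact ⟨v, hv, he ha ▸ hs⟩
  have hex : ∀ l, ∃ s, ∀ τ, ϑ l = some τ → τ.Stub ϑ s := by
    intro l
    cases hl : ϑ l with
    | none => exact ⟨.unit, by simp⟩
    | some τ =>
      obtain ⟨s, v, -, hs, -⟩ := hstub hS₁ hl
      exact ⟨s, by simpa using hs⟩
  choose f hf using hex
  let D : Set Loc := {l | ∃ τ, ϑ l = some τ ∧ ¬ τ.ArrowFree}
  have hfD : ∀ l ∈ D, IsValue (f l) := fun l ⟨τ, hl, _⟩ => (hf l τ hl).isValue LP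
  have hD : ∀ {l τ}, ϑ l = some τ → τ.ArrowFree → l ∉ D := by
    rintro l τ hl ha ⟨τ', hl', ha'⟩
    rw [hl] at hl'
    cases hl'
    exact ha' ha
  have hagree : ∀ {S : State Lock Actor}, S.WellTyped LP ϑ →
      State.Agree ϑ S (S.overwrite D f hfD) := by
    intro S hS
    refine ⟨State.env_overwrite.symm, fun l τ hl => (hS l τ hl).1, fun l τ hl ha => ?_⟩
    obtain ⟨v, hv, hs⟩ := hfirst hS hl ha
    exact ⟨v, hv, by rw [State.val_overwrite_of_notMem (hD hl ha), hv],
      hs.noHigherOrderState τ ha⟩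
  -- Both states are equivalent to `L`, which serves as the common partner.
  have hcospan : World.Cospan ⟨(S₁.low A).env, L.env, idOn (S₁.low A).dom⟩
      ⟨(S₂.low A).env, L.env, idOn (S₂.low A).dom⟩ (World.diag ϑ) := by
    refine ⟨by rwa [henv₁], by rwa [henv₂], fun l₁ l₂ l₀ k₁ k₂ => ?_⟩
    obtain ⟨rfl, hl⟩ := mem_idOn.1 k₁
    obtain ⟨rfl, -⟩ := mem_idOn.1 k₂
    refine mem_idOn.2 ⟨rfl, ?_⟩
    obtain ⟨τ, hτ⟩ := State.mem_dom_iff.1 hl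
    rw [henv₁] at hτ
    simp [StateEnv.dom, hle _ _ hτ]
  refine ⟨_, _, hagree hS₁, hagree hS₂, fun m => ⟨fun l τ hl => ?_, fun l τ hl => ?_,
    fun l₁ l₂ hl => ?_, fun l₁ l₂ hl => ?_⟩⟩
  · rw [State.env_overwrite]
    exact (hS₁ l τ hl).1
  · rw [State.env_overwrite]
    exact (hS₂ l τ hl).1
  · obtain ⟨rfl, hmem⟩ := mem_idOn.1 hl
    exact ⟨hmem, hmem⟩
  · obtain ⟨rfl, hmem⟩ := mem_idOn.1 hl
    obtain ⟨τ, hl⟩ := Option.isSome_iff_exists.1 hmem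
    by_cases ha : τ.ArrowFree
    · obtain ⟨v₁, hv₁, hs₁⟩ := hfirst hS₁ hl ha
      obtain ⟨v₂, hv₂, hs₂⟩ := hfirst hS₂ hl ha
      refine ⟨τ, v₁, v₂, hl, hl, by rw [State.val_overwrite_of_notMem (hD hl ha), hv₁],
        by rw [State.val_overwrite_of_notMem (hD hl ha), hv₂], ?_⟩
      by_cases hP : A.Sees τ.pol
      -- Visible function-free type: both values are related to the value of `L` at this location.
      -- Index 0 is enough because the type contains no functions.
      · obtain ⟨τ₁, u₁, u, e₁, e₁', k₁, k₁', b₁⟩ := low₁.2.2.2 l₁ l₁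
          (mem_idOn.2 ⟨rfl, State.mem_dom_low (hS₁ _ _ hl).1 hP⟩)
        obtain ⟨τ₂, u₂, u', e₂, e₂', k₂, k₂', b₂⟩ := low₂.2.2.2 l₁ l₁
          (mem_idOn.2 ⟨rfl, State.mem_dom_low (hS₂ _ _ hl).1 hP⟩)
        have t₁ := hle _ _ e₁'
        have t₂ := hle _ _ e₂'
        rw [hl] at t₁ t₂
        cases t₁
        cases t₂
        rw [k₁'] at k₂'
        cases k₂'
        rw [State.val_eq_of_val_low k₁] at hv₁
        rw [State.val_eq_of_val_low k₂] at hv₂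
        cases hv₁
        cases hv₂
        exact BVal.cospan hcospan τ ha b₁ b₂
      · cases τ with
        | ann a P =>
          exact bVal_ann.2 (.inr ⟨hP, uVal_ann.1 hs₁.uVal, uVal_ann.1 hs₂.uVal⟩)
    · obtain ⟨_, v₁, hv₁, -⟩ := hstub hS₁ hl
      obtain ⟨_, v₂, hv₂, -⟩ := hstub hS₂ hl
      have hmem : l₁ ∈ D := ⟨τ, hl, ha⟩
      exact ⟨τ, f l₁, f l₁, hl, hl, State.val_overwrite_of_mem hmem hv₁,
        State.val_overwrite_of_mem hmem hv₂, (hf l₁ τ hl).bVal⟩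

/-! ## Knowledge -/

/-- Indistinguishable visible traces of function-free writes give the same knowledge. -/
theorem Know.subset_of_traceIndist {e : Expr Lock Actor} {L : State Lock Actor} {K : Set Lock}
    {Ω₁ Ω₂ : List (Obs Lock Actor)} {m : ℕ} {W : World Lock Actor} (hW₁ : L.env.Le W.env₁)
    (hW : idOn L.dom ≤ W.bij) (hv : ∀ ω ∈ Ω₂, ω.Visible A LP) (ha : ∀ ω ∈ Ω₁, ω.ArrowFree)
    (h : TraceIndist A LP m W Ω₂ Ω₁) : Know A LP e Ω₁ L K ⊆ Know A LP e Ω₂ L K := by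
  rintro S ⟨hS, Ω, e', S', K', hsteps, U, ⟨-, hU₂, hU⟩, hΩ⟩
  -- The run from `S` is kept; only the world changes, to the composition of `W` (from `Ω₂` to `Ω₁`)
  -- with `U` (from `Ω₁` to `Ω`). It does not depend on the index `k`.
  refine ⟨hS, Ω, e', S', K', hsteps, ⟨W.env₁, U.env₂, W.bij.trans U.bij⟩,
    ⟨hW₁, hU₂, fun l l' hl => ?_⟩, fun k => ?_⟩
  · have hl' := hl
    obtain ⟨rfl, -⟩ := mem_idOn.1 hl'
    exact (PEquiv.mem_trans _ _ _ _).2 ⟨l, hW l l hl, hU l l hl⟩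
  · refine TraceIndist.cospan (W₁ := W) (W₂ := U.symm)
      (W := ⟨W.env₁, U.env₂, W.bij.trans U.bij⟩)
      ⟨.refl _, .refl _, fun l₁ l₂ l₀ k₁ k₂ => ?_⟩ ha hv h ((hΩ k).symm ha)
    exact (PEquiv.mem_trans _ _ _ _).2 ⟨l₀, k₁, (PEquiv.mem_iff_mem _).1 k₂⟩

theorem World.diag_le {θ θ' : StateEnv Lock Actor} (h : θ.Le θ') :
    (World.diag θ).Le (World.diag θ') := by
  refine ⟨h, h, fun l l' hl => ?_⟩
  obtain ⟨rfl, hmem⟩ := mem_idOn.1 hl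
  obtain ⟨τ, hτ⟩ := Option.isSome_iff_exists.1 hmem
  exact mem_idOn.2 ⟨rfl, Option.isSome_iff_exists.2 ⟨τ, h _ _ hτ⟩⟩

end

end Security

end WHR

-- Flow-Lock security of self-related programs

theorem mainTheorem4 {Lock : Type*} {Actor : Type*}
    (LP : Lock → WHR.Policy Lock Actor) (A : WHR.Attacker Lock Actor)
    (e : WHR.Expr Lock Actor) (τ : WHR.Ty Lock Actor) (K : Set Lock)
    (θ : WHR.StateEnv Lock Actor) (L : WHR.State Lock Actor)
    (hL : L.IsLow A)
    (he : e.NoHigherOrderState (θ.extend L))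
    (hrel : ∀ m, WHR.BExp A LP m τ e e (WHR.World.diag (θ.extend L)) K K) :
    WHR.FlowLockSecure A LP e L K θ := by
  rintro Ω₁ Ω₂ ω₁ ω₂ K₁ K₂ ⟨S₁, S₁', e₁, hS₁, hL₁, steps₁⟩ ⟨S₂, S₂', e₂, hS₂, hL₂, steps₂⟩ hΩ hK
  obtain ⟨T₁, T₂, agree₁, agree₂, hT⟩ := WHR.exists_agree_stateIndist hL hL₁ hL₂ hS₁ hS₂
  obtain ⟨n₁, r₁⟩ := steps₁.exists_visibleRun
  obtain ⟨n₂, r₂⟩ := steps₂.exists_visibleRun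
  obtain ⟨r₁, free₁⟩ := r₁.transfer he agree₁
  obtain ⟨r₂, free₂⟩ := r₂.transfer he agree₂
  have hθ : θ.Le (θ.extend L) := fun l τ h => by simp [WHR.StateEnv.extend, h]
  -- The index is the total length of the two runs. Irrelevance is assumed in the world of `θ`,
  -- which lies below the world of `θ.extend L`.
  obtain ⟨W, hW, hind⟩ := WHR.BExp.exists_traceIndist hK (n₁ + n₂) le_rfl r₁ r₂
    (WHR.World.diag_le hθ) hΩ (hT _) (hrel _)
  have hle := hL₁.env_le_extend hL hS₁
  have hbij : WHR.idOn L.dom ≤ (WHR.World.diag (θ.extend L)).bij := fun l l' hl => by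
    obtain ⟨rfl, hmem⟩ := WHR.mem_idOn.1 hl
    obtain ⟨τ, hτ⟩ := WHR.State.mem_dom_iff.1 hmem
    exact WHR.mem_idOn.2 ⟨rfl, Option.isSome_iff_exists.2 ⟨τ, hle _ _ hτ⟩⟩
  refine Set.Subset.antisymm ?_ ?_
  -- The relation obtained goes from the first trace to the second; this inclusion needs the
  -- converse, available because the writes are function-free.
  · refine WHR.Know.subset_of_traceIndist (W := W.symm) (hle.trans hW.2.1) (fun l l' hl => ?_)
      steps₂.forall_visible free₁ (hind.symm free₁)
    refine (PEquiv.mem_iff_mem _).2 (hW.2.2 _ _ (hbij _ _ ?_))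
    exact WHR.mem_idOn.2 ⟨(WHR.mem_idOn.1 hl).1.symm,
      (WHR.mem_idOn.1 hl).1 ▸ (WHR.mem_idOn.1 hl).2⟩
  · exact WHR.Know.subset_of_traceIndist (hle.trans hW.1) (hbij.trans hW.2.2)
      steps₁.forall_visible free₂ hind
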